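/- Let $G$ be a connected Lie group with Lie algebra $\mathfrak g$, acting smoothly on a connected (finite-dimensional, Hausdorff, second countable) symplectic manifold $(M,\omega)$. Let $\operatorname{sgrad} f$ be the Hamiltonian vector field of $f$ ($\omega(\operatorname{sgrad} f,\cdot)=df$), and $\{f,g\}=\omega(\operatorname{sgrad} f,\operatorname{sgrad} g)$. Suppose the action is Hamiltonian with smooth moment map $\Phi:M\to\mathfrak g^*$: $G$ acts by symplectomorphisms, and for $\xi,\eta\in\mathfrak g$ the infinitesimal action of $\xi$ on $M$ is $\operatorname{sgrad} f_\xi$, where $f_\xi(x)=\Phi(x)(\xi)$, and $f_{[\xi,\eta]}=\{f_\xi,f_\eta\}$. A property holds *for general* points of a topological space if it holds at all points of an open dense subset. For a linear space $\mathcal F$ of smooth functions on a symplectic manifold $N$, let $F_x\subset T_x^*N$ be the span of the differentials $df(x)$, $f\in\mathcal F$, and let $K_x\subset F_x$ be the kernel of the Poisson structure restricted to $F_x$. If there are constants $l,r$ such that $\dim F_x=l$ and $\dim K_x=r$ for general $x\in N$, we say that $\mathcal F$ has differential dimension $\operatorname{ddim}\mathcal F=l$ and differential index $\operatorname{dind}\mathcal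 F=r$. An *algebra* of functions is a linear space of smooth functions closed under the Poisson bracket. It is *complete* on $N$ if it has a differential dimension and a differential index and $\operatorname{ddim}\mathcal F+\operatorname{dind}\mathcal F=\dim N$. Let $\mathcal F_2$ be the algebra of $G$-invariant functions in $C^\infty(M)$. Assume that there is an integer $m$ such that for general $x\in M$ one has $\dim G\cdot x=m$ and $$\operatorname{span}\{df(x): f\in\mathcal F_2\}=\operatorname{ann}\bigl(T_x(G\cdot x)\bigr).$$ Let $\mathcal A\subset C^\infty(\mathfrak g^*)$ be an algebra of functions with respect to the Lie–Poisson bracket $\{h_1,h_2\}(\mu)=\mu([dh_1(\mu),dh_2(\mu)])$, and let $\Phi^*(\mathcal A)=\{h\circ\Phi: h\in\mathcal A\}$. Each coadjoint orbit $\mathcal O(\mu)\subset\mathfrak g^*$ is regarded as a symplectic manifold with its Kirillov–Kostant–Souriau form, $\omega_\nu(\mathrm{ad}^*_\xi\nu,\mathrm{ad}^*_\eta\nu)=\nu([\xi,\eta])$, and with its topology of a homogeneous space of $G$, and $\mathcal A$ is restricted to it. Suppose that the differential dimensions and indices in question are defined: $\Phi^*(\mathcal A)+\mathcal F_2$ has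 a differential dimension and a differential index on $M$, and for general $\mu\in\Phi(M)$ the restriction of $\mathcal A$ to $\mathcal O(\mu)$ has a differential dimension and a differential index on $\mathcal O(\mu)$. Then $\Phi^*(\mathcal A)+\mathcal F_2$ is a complete algebra on $M$ if and only if $\mathcal A$ is a complete algebra on the coadjoint orbit $\mathcal O(\mu)$ for general $\mu\in\Phi(M)$ (that is, for all $\mu$ in an open dense subset of $\Phi(M)$ with the subspace topology). -/

import Mathlib

open scoped Manifold ContDiff

noncomputable section

/-- `p x` holds for general `x`: it holds at all points of some open dense subset. -/
def ForGeneral {X : Type*} [TopologicalSpace X] (p : X → Prop) : Prop :=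
  ∃ U : Set X, IsOpen U ∧ Dense U ∧ ∀ x ∈ U, p x

/-! ### Symplectic linear algebra -/

/-- A symplectic form on a real vector space. -/
structure LinearSymplecticForm (V : Type*) [AddCommGroup V] [Module ℝ V] where
  form : LinearMap.BilinForm ℝ V
  alt : form.IsAlt
  nondegenerate : form.Nondegenerate

namespace LinearSymplecticForm

variable {V : Type*} [AddCommGroup V] [Module ℝ V] [FiniteDimensional ℝ V]

/-- The vector `♯α` with `σ(♯α, v) = α(v)` for all `v`. -/
def sharp (σ : LinearSymplecticForm V) (α : Module.Dual ℝ V) : V :=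
  (σ.form.toDual σ.nondegenerate).symm α

theorem form_sharp (σ : LinearSymplecticForm V) (α : Module.Dual ℝ V) (v : V) :
    σ.form (σ.sharp α) v = α v :=
  LinearMap.BilinForm.apply_toDual_symm_apply α v

/-- The Poisson structure on the dual space: `{α, β} = σ(♯α, ♯β)`. -/
def poisson (σ : LinearSymplecticForm V) (α β : Module.Dual ℝ V) : ℝ :=
  σ.form (σ.sharp α) (σ.sharp β)

/-- The kernel of the Poisson structure restricted to a subspace `F` of the dual space. -/
def poissonKer (σ : LinearSymplecticForm V) (F : Submodule ℝ (Module.Dual ℝ V)) :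
    Submodule ℝ (Module.Dual ℝ V) where
  carrier := {α | α ∈ F ∧ ∀ β ∈ F, σ.poisson α β = 0}
  zero_mem' := ⟨F.zero_mem, fun β _ => by simp [poisson, sharp]⟩
  add_mem' := fun {a b} ha hb => ⟨F.add_mem ha.1 hb.1, fun β hβ => by
    have h1 := ha.2 β hβ
    have h2 := hb.2 β hβ
    simp only [poisson, sharp, map_add, LinearMap.add_apply] at h1 h2 ⊢
    rw [h1, h2, add_zero]⟩
  smul_mem' := fun c a ha => ⟨F.smul_mem c ha.1, fun β hβ => by
    have h1 := ha.2 β hβ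
    simp only [poisson, sharp, map_smul, LinearMap.smul_apply] at h1 ⊢
    rw [h1, smul_zero]⟩

end LinearSymplecticForm

/-- Let `F x` be a family of subspaces of the cotangent spaces of a symplectic manifold `X` (the
spaces spanned at `x` by the differentials of the functions of an algebra). The algebra has
differential dimension `l` and differential index `r`: on an open dense subset, `dim F x = l`, and
the kernel of the Poisson structure restricted to `F x` has dimension `r`. -/
def HasDiffDims {X : Type*} [TopologicalSpace X] {T : X → Type*} [∀ x, AddCommGroup (T x)]
    [∀ x, Module ℝ (T x)] [∀ x, FiniteDimensional ℝ (T x)]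
    (σ : ∀ x, LinearSymplecticForm (T x)) (F : ∀ x, Submodule ℝ (Module.Dual ℝ (T x)))
    (l r : ℕ) : Prop :=
  ForGeneral fun x =>
    Module.finrank ℝ (F x) = l ∧ Module.finrank ℝ ((σ x).poissonKer (F x)) = r

/-! ### Symplectic manifolds and algebras of functions on them -/

section SymplecticManifold

variable {E : Type*} [NormedAddCommGroup E] [NormedSpace ℝ E] [FiniteDimensional ℝ E]
  {M : Type*} [TopologicalSpace M] [ChartedSpace E M]

instance instFiniteDimensionalTangentSpaceModel (x : M) :
    FiniteDimensional ℝ (TangentSpace 𝓘(ℝ, E) x) :=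
  inferInstanceAs (FiniteDimensional ℝ E)

/-- The coefficient `σ(u, v)` of a field of bilinear forms in the chart `e`, as a function on the
target of `e`; here `u, v` are constant vector fields on the model space. -/
def chartCoeff (σ : ∀ x : M, LinearSymplecticForm (TangentSpace 𝓘(ℝ, E) x))
    (e : OpenPartialHomeomorph M E) (u v : E) (y : E) : ℝ :=
  (σ (e.symm y)).form (mfderiv 𝓘(ℝ, E) 𝓘(ℝ, E) e.symm y u) (mfderiv 𝓘(ℝ, E) 𝓘(ℝ, E) e.symm y v)

variable (E M) in
/-- A symplectic form on a manifold: a smooth field of symplectic forms on the tangent spaces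
which is closed. -/
structure SymplecticForm where
  at_ : ∀ x : M, LinearSymplecticForm (TangentSpace 𝓘(ℝ, E) x)
  smooth : ∀ e ∈ atlas E M, ∀ u v : E, ContDiffOn ℝ ∞ (chartCoeff at_ e u v) e.target
  closed : ∀ e ∈ atlas E M, ∀ y ∈ e.target, ∀ u v w : E,
    fderiv ℝ (chartCoeff at_ e v w) y u + fderiv ℝ (chartCoeff at_ e w u) y v
      + fderiv ℝ (chartCoeff at_ e u v) y w = 0

/-- The differential `df(x)` of a real function on a manifold, as an element of `T*_x M`. -/
def differential (E : Type*) [NormedAddCommGroup E] [NormedSpace ℝ E] {M : Type*}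
    [TopologicalSpace M] [ChartedSpace E M] (f : M → ℝ) (x : M) :
    Module.Dual ℝ (TangentSpace 𝓘(ℝ, E) x) :=
  (mfderiv 𝓘(ℝ, E) 𝓘(ℝ, ℝ) f x : TangentSpace 𝓘(ℝ, E) x →L[ℝ] ℝ).toLinearMap

/-- The Hamiltonian vector field of `f`: `σ(sgrad f, v) = df(v)`. -/
def SymplecticForm.sgrad (σ : SymplecticForm E M) (f : M → ℝ) (x : M) :
    TangentSpace 𝓘(ℝ, E) x :=
  (σ.at_ x).sharp (differential E f x)

/-- The canonical Poisson bracket `{f, g} = σ(sgrad f, sgrad g)`. -/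
def SymplecticForm.bracket (σ : SymplecticForm E M) (f g : M → ℝ) (x : M) : ℝ :=
  (σ.at_ x).form (σ.sgrad f x) (σ.sgrad g x)

/-- The span of the differentials at `x` of the functions belonging to `F`. -/
def diffSpan (E : Type*) [NormedAddCommGroup E] [NormedSpace ℝ E] {M : Type*}
    [TopologicalSpace M] [ChartedSpace E M] (F : Submodule ℝ (M → ℝ)) (x : M) :
    Submodule ℝ (Module.Dual ℝ (TangentSpace 𝓘(ℝ, E) x)) :=
  Submodule.span ℝ {α | ∃ f ∈ F, differential E f x = α}

/-- `F` is an algebra of smooth functions with respect to the Poisson bracket. -/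
structure SymplecticForm.IsPoissonAlgebra (σ : SymplecticForm E M)
    (F : Submodule ℝ (M → ℝ)) : Prop where
  smooth : ∀ f ∈ F, ContMDiff 𝓘(ℝ, E) 𝓘(ℝ, ℝ) ∞ f
  bracket_mem : ∀ f ∈ F, ∀ g ∈ F, σ.bracket f g ∈ F

/-- The algebra `F` on `M` has differential dimension `l` and differential index `r`. -/
def SymplecticForm.HasDims (σ : SymplecticForm E M) (F : Submodule ℝ (M → ℝ)) (l r : ℕ) : Prop :=
  HasDiffDims σ.at_ (diffSpan E F) l r

/-- `F` is a complete algebra on `M`: `ddim F + dind F = dim M`. -/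
def SymplecticForm.IsCompleteAlgebra (σ : SymplecticForm E M) (F : Submodule ℝ (M → ℝ)) : Prop :=
  σ.IsPoissonAlgebra F ∧ ∃ l r : ℕ, σ.HasDims F l r ∧ l + r = Module.finrank ℝ E

end SymplecticManifold

/-! ### The Lie algebra, its dual and the coadjoint orbits

The Lie algebra `𝔤 = T_1 G` of a Lie group `G` modelled on `𝔤₀` is, by the definition of tangent
spaces, the vector space `𝔤₀` with the Lie bracket of left-invariant vector fields, and the dual
space `𝔤*` is `𝔤₀ →L[ℝ] ℝ`. -/

section LieGroup

theorem lieGroupThree {𝔤₀ : Type*} [NormedAddCommGroup 𝔤₀] [NormedSpace ℝ 𝔤₀] (G : Type*)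
    [TopologicalSpace G] [ChartedSpace 𝔤₀ G] [Group G] [LieGroup 𝓘(ℝ, 𝔤₀) ∞ G] :
    LieGroup 𝓘(ℝ, 𝔤₀) (minSmoothness ℝ 3) G :=
  LieGroup.of_le (n := ∞) (by
    rw [minSmoothness_of_isRCLikeNormedField]
    exact WithTop.coe_le_coe.2 (le_top : (3 : ℕ∞) ≤ ⊤))

variable {𝔤₀ : Type*} [NormedAddCommGroup 𝔤₀] [NormedSpace ℝ 𝔤₀] [FiniteDimensional ℝ 𝔤₀]
  (G : Type*) [TopologicalSpace G] [ChartedSpace 𝔤₀ G] [Group G] [LieGroup 𝓘(ℝ, 𝔤₀) ∞ G]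

/-- The Lie bracket of the Lie algebra of `G`, as a bilinear map. -/
def lieBr : 𝔤₀ →ₗ[ℝ] 𝔤₀ →ₗ[ℝ] 𝔤₀ :=
  have := lieGroupThree (𝔤₀ := 𝔤₀) G
  show GroupLieAlgebra 𝓘(ℝ, 𝔤₀) G →ₗ[ℝ] GroupLieAlgebra 𝓘(ℝ, 𝔤₀) G →ₗ[ℝ]
      GroupLieAlgebra 𝓘(ℝ, 𝔤₀) G from
    LinearMap.mk₂ ℝ (fun ξ η => ⁅ξ, η⁆) add_lie smul_lie lie_add
      (fun c ξ η => lie_smul c ξ η)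

theorem lieBr_apply (ξ η : 𝔤₀) :
    lieBr G ξ η = Bracket.bracket (L := GroupLieAlgebra 𝓘(ℝ, 𝔤₀) G)
      (M := GroupLieAlgebra 𝓘(ℝ, 𝔤₀) G) ξ η := rfl

theorem lieBr_skew (ξ η : 𝔤₀) : lieBr G ξ η = -lieBr G η ξ := by
  have := lieGroupThree (𝔤₀ := 𝔤₀) G
  exact (lie_skew (L := GroupLieAlgebra 𝓘(ℝ, 𝔤₀) G) ξ η).symm

/-- The adjoint action `Ad_g`, the derivative at `1` of the conjugation by `g`. -/
def bigAd (g : G) : 𝔤₀ →L[ℝ] 𝔤₀ :=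
  mfderiv 𝓘(ℝ, 𝔤₀) 𝓘(ℝ, 𝔤₀) (fun h : G => g * h * g⁻¹) 1

/-- The coadjoint action `(Ad*_g μ)(ξ) = μ(Ad_{g⁻¹} ξ)`. -/
def coAd (g : G) (μ : 𝔤₀ →L[ℝ] ℝ) : 𝔤₀ →L[ℝ] ℝ :=
  μ.comp (bigAd G g⁻¹)

/-- The infinitesimal coadjoint action `ξ ↦ ad*_ξ ν`, where `(ad*_ξ ν)(η) = -ν([ξ, η])`. -/
def adStar (ν : 𝔤₀ →L[ℝ] ℝ) : 𝔤₀ →ₗ[ℝ] (𝔤₀ →L[ℝ] ℝ) where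
  toFun ξ := -(ν.comp (LinearMap.toContinuousLinearMap (lieBr G ξ)))
  map_add' ξ η := by ext ζ; simp; ring
  map_smul' c ξ := by ext ζ; simp

theorem adStar_apply (ν : 𝔤₀ →L[ℝ] ℝ) (ξ η : 𝔤₀) : adStar G ν ξ η = -ν (lieBr G ξ η) := rfl

/-- The coadjoint orbit `O(μ)`, with its topology of a homogeneous space of `G`, i.e. the quotient
topology along `g ↦ Ad*_g μ`. -/
def CoadjointOrbit (μ : 𝔤₀ →L[ℝ] ℝ) : Type _ :=
  {ν : 𝔤₀ →L[ℝ] ℝ // ∃ g : G, coAd G g μ = ν}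

instance instTopologicalSpaceCoadjointOrbit (μ : 𝔤₀ →L[ℝ] ℝ) :
    TopologicalSpace (CoadjointOrbit G μ) :=
  TopologicalSpace.coinduced (fun g : G => (⟨coAd G g μ, g, rfl⟩ : CoadjointOrbit G μ))
    inferInstance

/-- The tangent space of a coadjoint orbit at its point `ν`: the space of all `ad*_ξ ν`. -/
def orbitTangent (ν : 𝔤₀ →L[ℝ] ℝ) : Submodule ℝ (𝔤₀ →L[ℝ] ℝ) :=
  LinearMap.range (adStar G ν)

/-- An element `ξ` of the Lie algebra with `ad*_ξ ν = u`. -/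
def orbitLift {ν : 𝔤₀ →L[ℝ] ℝ} (u : orbitTangent G ν) : 𝔤₀ :=
  (LinearMap.mem_range.mp u.2).choose

theorem adStar_orbitLift {ν : 𝔤₀ →L[ℝ] ℝ} (u : orbitTangent G ν) :
    adStar G ν (orbitLift G u) = u :=
  (LinearMap.mem_range.mp u.2).choose_spec

theorem orbitForm_eq_left {ν : 𝔤₀ →L[ℝ] ℝ} (u v : orbitTangent G ν) :
    ν (lieBr G (orbitLift G u) (orbitLift G v)) = -(u : 𝔤₀ →L[ℝ] ℝ) (orbitLift G v) := by
  have h := congrArg (fun f : 𝔤₀ →L[ℝ] ℝ => f (orbitLift G v)) (adStar_orbitLift G u)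
  simp only [adStar_apply] at h
  rw [← h, neg_neg]

theorem orbitForm_eq_right {ν : 𝔤₀ →L[ℝ] ℝ} (u v : orbitTangent G ν) :
    ν (lieBr G (orbitLift G u) (orbitLift G v)) = (v : 𝔤₀ →L[ℝ] ℝ) (orbitLift G u) := by
  rw [lieBr_skew, map_neg, orbitForm_eq_left, neg_neg]

/-- The Kirillov-Kostant-Souriau form on the tangent space of a coadjoint orbit at `ν`:
`σ(ad*_ξ ν, ad*_η ν) = ν([ξ, η])`. -/
def orbitForm (ν : 𝔤₀ →L[ℝ] ℝ) : LinearMap.BilinForm ℝ (orbitTangent G ν) :=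
  LinearMap.mk₂ ℝ (fun u v => ν (lieBr G (orbitLift G u) (orbitLift G v)))
    (fun u u' v => by simp only [orbitForm_eq_left]; simp; ring)
    (fun c u v => by simp only [orbitForm_eq_left]; simp)
    (fun u v v' => by simp only [orbitForm_eq_right]; simp)
    (fun c u v => by simp only [orbitForm_eq_right]; simp)

theorem orbitForm_apply (ν : 𝔤₀ →L[ℝ] ℝ) (ξ η : 𝔤₀) :
    orbitForm G ν ⟨adStar G ν ξ, ξ, rfl⟩ ⟨adStar G ν η, η, rfl⟩ = ν (lieBr G ξ η) := by
  set u : orbitTangent G ν := ⟨adStar G ν ξ, ξ, rfl⟩ with hu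
  set v : orbitTangent G ν := ⟨adStar G ν η, η, rfl⟩ with hv
  have h1 : orbitForm G ν u v = -(adStar G ν ξ) (orbitLift G v) := orbitForm_eq_left G u v
  have h2 : adStar G ν (orbitLift G v) = adStar G ν η := adStar_orbitLift G v
  have h3 := congrArg (fun f : 𝔤₀ →L[ℝ] ℝ => f ξ) h2
  simp only [adStar_apply] at h1 h3
  rw [h1, lieBr_skew G ξ (orbitLift G v), lieBr_skew G ξ η, map_neg, map_neg, neg_neg, ← h3]

/-- The symplectic structure of the coadjoint orbits. -/
def orbitSymplectic (ν : 𝔤₀ →L[ℝ] ℝ) : LinearSymplecticForm (orbitTangent G ν) where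
  form := orbitForm G ν
  alt := fun u => by
    have h : ν (lieBr G (orbitLift G u) (orbitLift G u)) = 0 := by
      have := congrArg ν (lieBr_skew G (orbitLift G u) (orbitLift G u))
      rw [map_neg] at this
      linarith
    exact h
  nondegenerate := by
    constructor
    · intro u hu
      apply Subtype.ext
      ext η
      have h := hu ⟨adStar G ν η, η, rfl⟩
      have hu' : u = ⟨adStar G ν (orbitLift G u), orbitLift G u, rfl⟩ :=
        Subtype.ext (adStar_orbitLift G u).symm
      rw [hu', orbitForm_apply] at h
      rw [← adStar_orbitLift G u, adStar_apply, h]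
      simp
    · intro v hv
      apply Subtype.ext
      ext ξ
      have h := hv ⟨adStar G ν ξ, ξ, rfl⟩
      have hv' : v = ⟨adStar G ν (orbitLift G v), orbitLift G v, rfl⟩ :=
        Subtype.ext (adStar_orbitLift G v).symm
      rw [hv', orbitForm_apply] at h
      rw [← adStar_orbitLift G v, adStar_apply, lieBr_skew, map_neg, h]
      simp

/-- The differential at `ν` of the restriction of `h : 𝔤* → ℝ` to the coadjoint orbit of `ν`. -/
def orbitDifferential (h : (𝔤₀ →L[ℝ] ℝ) → ℝ) (ν : 𝔤₀ →L[ℝ] ℝ) :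
    Module.Dual ℝ (orbitTangent G ν) :=
  (fderiv ℝ h ν).toLinearMap ∘ₗ (orbitTangent G ν).subtype

/-- The span of the differentials at `ν` of the restrictions of the functions in `A` to the
coadjoint orbit of `ν`. -/
def orbitDiffSpan (A : Submodule ℝ ((𝔤₀ →L[ℝ] ℝ) → ℝ)) (ν : 𝔤₀ →L[ℝ] ℝ) :
    Submodule ℝ (Module.Dual ℝ (orbitTangent G ν)) :=
  Submodule.span ℝ {α | ∃ h ∈ A, orbitDifferential G h ν = α}

/-- The restriction of `A` to the symplectic manifold `O(μ)` has differential dimension `l` and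
differential index `r`. -/
def HasOrbitDims (A : Submodule ℝ ((𝔤₀ →L[ℝ] ℝ) → ℝ)) (μ : 𝔤₀ →L[ℝ] ℝ) (l r : ℕ) : Prop :=
  HasDiffDims (X := CoadjointOrbit G μ) (fun ν => orbitSymplectic G ν.1)
    (fun ν => orbitDiffSpan G A ν.1) l r

/-- `A` is a complete algebra on `O(μ)`: its restriction to `O(μ)` is closed under the Poisson
bracket of the symplectic manifold `O(μ)`, and `ddim + dind = dim O(μ)`. -/
def IsCompleteOnOrbit (A : Submodule ℝ ((𝔤₀ →L[ℝ] ℝ) → ℝ)) (μ : 𝔤₀ →L[ℝ] ℝ) : Prop :=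
  (∀ h₁ ∈ A, ∀ h₂ ∈ A, ∃ h₃ ∈ A, ∀ ν : CoadjointOrbit G μ,
    h₃ ν.1 = (orbitSymplectic G ν.1).poisson (orbitDifferential G h₁ ν.1)
      (orbitDifferential G h₂ ν.1)) ∧
  ∃ l r : ℕ, HasOrbitDims G A μ l r ∧ l + r = Module.finrank ℝ (orbitTangent G μ)

/-- The differential `dh(μ)` of a function on `𝔤*`, as an element of `𝔤 = 𝔤**`. -/
def dualGrad {𝔤₀ : Type*} [NormedAddCommGroup 𝔤₀] [NormedSpace ℝ 𝔤₀] [FiniteDimensional ℝ 𝔤₀]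
    (h : (𝔤₀ →L[ℝ] ℝ) → ℝ) (μ : 𝔤₀ →L[ℝ] ℝ) : 𝔤₀ :=
  (Module.evalEquiv ℝ 𝔤₀).symm
    ((fderiv ℝ h μ).toLinearMap ∘ₗ (LinearMap.toContinuousLinearMap (𝕜 := ℝ) (E := 𝔤₀)).toLinearMap)

theorem apply_dualGrad {𝔤₀ : Type*} [NormedAddCommGroup 𝔤₀] [NormedSpace ℝ 𝔤₀]
    [FiniteDimensional ℝ 𝔤₀] (h : (𝔤₀ →L[ℝ] ℝ) → ℝ) (μ ν : 𝔤₀ →L[ℝ] ℝ) :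
    ν (dualGrad h μ) = fderiv ℝ h μ ν := by
  have := Module.apply_evalEquiv_symm_apply ℝ 𝔤₀ ν.toLinearMap
    ((fderiv ℝ h μ).toLinearMap ∘ₗ
      (LinearMap.toContinuousLinearMap (𝕜 := ℝ) (E := 𝔤₀)).toLinearMap)
  exact this

/-- The Lie-Poisson bracket `{h₁, h₂}(μ) = μ([dh₁(μ), dh₂(μ)])` on `𝔤*`. -/
def liePoisson (h₁ h₂ : (𝔤₀ →L[ℝ] ℝ) → ℝ) (μ : 𝔤₀ →L[ℝ] ℝ) : ℝ :=
  μ (lieBr G (dualGrad h₁ μ) (dualGrad h₂ μ))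

/-- `A` is an algebra of smooth functions on `𝔤*` with respect to the Lie-Poisson bracket. -/
structure IsLiePoissonAlgebra (A : Submodule ℝ ((𝔤₀ →L[ℝ] ℝ) → ℝ)) : Prop where
  smooth : ∀ h ∈ A, ContDiff ℝ ∞ h
  bracket_mem : ∀ h₁ ∈ A, ∀ h₂ ∈ A, liePoisson G h₁ h₂ ∈ A

/-! ### Hamiltonian actions -/

variable {E : Type*} [NormedAddCommGroup E] [NormedSpace ℝ E] [FiniteDimensional ℝ E]
  {M : Type*} [TopologicalSpace M] [ChartedSpace E M] [MulAction G M]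

/-- The infinitesimal action `𝔤 → T_x M`, the derivative at `1` of `g ↦ g • x`. Its value at `ξ` is
the velocity at `x` of the one-parameter group of transformations of `M` generated by `ξ`. -/
def infAction (𝔤₀ E : Type*) [NormedAddCommGroup 𝔤₀] [NormedSpace ℝ 𝔤₀]
    [NormedAddCommGroup E] [NormedSpace ℝ E] (G : Type*) [TopologicalSpace G]
    [ChartedSpace 𝔤₀ G] [Group G] {M : Type*} [TopologicalSpace M] [ChartedSpace E M]
    [MulAction G M] (x : M) : 𝔤₀ →L[ℝ] TangentSpace 𝓘(ℝ, E) x :=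
  mfderiv 𝓘(ℝ, 𝔤₀) 𝓘(ℝ, E) (fun g : G => g • x) 1

/-- The action of `G` on `(M, σ)` is Hamiltonian with moment map `Φ`: `G` acts by
symplectomorphisms, the infinitesimal action of `ξ` is the Hamiltonian vector field of
`f_ξ = Φ(·)(ξ)`, and `f_{[ξ, η]} = {f_ξ, f_η}`. -/
structure IsHamiltonianAction (σ : SymplecticForm E M) (Φ : M → (𝔤₀ →L[ℝ] ℝ)) : Prop where
  symplectic : ∀ (g : G) (x : M) (u v : TangentSpace 𝓘(ℝ, E) x),
    (σ.at_ (g • x)).form (mfderiv 𝓘(ℝ, E) 𝓘(ℝ, E) (fun y : M => g • y) x u)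
      (mfderiv 𝓘(ℝ, E) 𝓘(ℝ, E) (fun y : M => g • y) x v) = (σ.at_ x).form u v
  smooth_moment : ContMDiff 𝓘(ℝ, E) 𝓘(ℝ, 𝔤₀ →L[ℝ] ℝ) ∞ Φ
  generates : ∀ (ξ : 𝔤₀) (x : M), σ.sgrad (fun y => Φ y ξ) x = infAction 𝔤₀ E G x ξ
  bracket : ∀ (ξ η : 𝔤₀) (x : M),
    Φ x (lieBr G ξ η) = σ.bracket (fun y => Φ y ξ) (fun y => Φ y η) x

/-- The algebra of smooth `G`-invariant functions on `M`. -/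
def invariantFunctions (E : Type*) [NormedAddCommGroup E] [NormedSpace ℝ E] (G M : Type*)
    [TopologicalSpace M] [ChartedSpace E M] [Group G] [MulAction G M] :
    Submodule ℝ (M → ℝ) where
  carrier := {f | ContMDiff 𝓘(ℝ, E) 𝓘(ℝ, ℝ) ∞ f ∧ ∀ (g : G) (x : M), f (g • x) = f x}
  zero_mem' := ⟨contMDiff_const, fun _ _ => rfl⟩
  add_mem' := fun {a b} ha hb => ⟨ha.1.add hb.1, fun g x => by
    simp only [Pi.add_apply, ha.2 g x, hb.2 g x]⟩
  smul_mem' := fun c a ha => ⟨by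
    have := (contMDiff_const (c := c) (I := 𝓘(ℝ, E)) (I' := 𝓘(ℝ, ℝ)) (n := ∞) (M := M)).mul ha.1
    exact this, fun g x => by
    simp only [Pi.smul_apply, ha.2 g x]⟩

/-- The pull-back `Φ*(A) = {h ∘ Φ | h ∈ A}`. -/
def pullback {M V : Type*} (Φ : M → V) (A : Submodule ℝ (V → ℝ)) : Submodule ℝ (M → ℝ) :=
  A.map (LinearMap.funLeft ℝ ℝ Φ)

/-- The general orbits have the same dimension `m`, and at a general point `x` the differentials of
the invariant functions span the annihilator of the tangent space `T_x(G · x)` to the orbit. -/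
def InvariantsSpanAnnihilators (𝔤₀ E : Type*) [NormedAddCommGroup 𝔤₀] [NormedSpace ℝ 𝔤₀]
    [NormedAddCommGroup E] [NormedSpace ℝ E] (G M : Type*) [TopologicalSpace G]
    [ChartedSpace 𝔤₀ G] [Group G] [TopologicalSpace M] [ChartedSpace E M]
    [MulAction G M] : Prop :=
  ∃ m : ℕ, ForGeneral fun x : M =>
    Module.finrank ℝ (LinearMap.range (infAction 𝔤₀ E G x).toLinearMap) = m ∧
    diffSpan E (invariantFunctions E G M) x =
      (LinearMap.range (infAction 𝔤₀ E G x).toLinearMap).dualAnnihilator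

end LieGroup

end

/-! Completeness is a coisotropy condition. If `F` is a subspace of the dual of a symplectic space
`V` and `U` is its image under `♯`, then the Poisson kernel of `F` corresponds to `U ∩ U^σ`. Since
`dim U + dim U^σ = dim V`, the equality `dim F + dim ker = dim V` says exactly that `U^σ ⊆ U`.

At a general point `x` let `ρ : 𝔤 → T_x M` be the infinitesimal action, `W` its range and `a` the
span of the differentials `dh(Φ x)`, `h ∈ A`. The differentials of `Φ*(A) + F₂` span `σ(ρ a, ·) +
ann W`, so `U = ρ a + W^σ` and `U^σ = W ∩ (ρ a)^σ`. Coisotropy then says that any `ξ` orthogonal to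
`a` for the form `σ(ρ ·, ρ ·)` lies in `a` modulo the kernel of this form
(`LinearSymplecticForm.coisotropic_iff`). The moment map identity turns this form into `Φ(x)([·,
·])`, so the condition depends only on `μ = Φ x`; it is `IsCoisotropicAt`. Applied to the
infinitesimal coadjoint action, the same criterion gives the same condition for `A` on the orbit at
`μ`. Thus completeness at `x` and completeness at `Φ x` on its orbit agree pointwise.

It remains to compare the notions of general point on `M`, on `Φ(M)` and on each orbit. The
dimension of the span, the Poisson rank and the orbit dimension are lower semicontinuous on `𝔤*` and
determine coisotropy, so on an open dense part of `Φ(M)` they are locally constant. Near such a `μ`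
there are images of general points of `M` and general points of `O(μ)`. The latter uses the
equivariance of `Φ`, obtained by integrating the infinitesimal identities over the connected group
`G`; this rests on `d(Ad) = ad`, computed from the second derivative of the multiplication in a
chart. -/

noncomputable section

open Topology Filter

/-! ### Coisotropic subspaces of the dual of a symplectic vector space -/

namespace LinearSymplecticForm

variable {V : Type*} [AddCommGroup V] [Module ℝ V] [FiniteDimensional ℝ V]

theorem sharp_form (σ : LinearSymplecticForm V) (v : V) : σ.sharp (σ.form v) = v :=
  (σ.form.toDual σ.nondegenerate).symm_apply_apply v

theorem form_eq_of_sharp_eq (σ : LinearSymplecticForm V) {α : Module.Dual ℝ V} {v : V}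
    (h : σ.sharp α = v) : α = σ.form v := by
  ext w
  rw [← h, form_sharp]

omit [FiniteDimensional ℝ V] in
theorem form_swap (σ : LinearSymplecticForm V) (v w : V) : σ.form v w = -σ.form w v :=
  (LinearMap.IsAlt.neg σ.alt w v).symm

theorem poisson_form_left (σ : LinearSymplecticForm V) (v : V) (β : Module.Dual ℝ V) :
    σ.poisson (σ.form v) β = -β v := by
  rw [poisson, sharp_form, form_swap, form_sharp]

/-- `sharp` as a linear equivalence. -/
def sharpEquiv (σ : LinearSymplecticForm V) : Module.Dual ℝ V ≃ₗ[ℝ] V :=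
  (σ.form.toDual σ.nondegenerate).symm

/-- `♯` carries the Poisson structure to `σ`, hence its kernel on `F` to the radical of `σ` on the
image of `F`. -/
theorem map_sharp_poissonKer (σ : LinearSymplecticForm V)
    (F : Submodule ℝ (Module.Dual ℝ V)) :
    (σ.poissonKer F).map σ.sharpEquiv.toLinearMap =
      F.map σ.sharpEquiv.toLinearMap ⊓ σ.form.orthogonal (F.map σ.sharpEquiv.toLinearMap) := by
  ext v
  simp only [Submodule.mem_map, Submodule.mem_inf, LinearMap.BilinForm.mem_orthogonal_iff]
  constructor
  · rintro ⟨α, hα, rfl⟩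
    refine ⟨⟨α, hα.1, rfl⟩, ?_⟩
    rintro _ ⟨β, hβ, rfl⟩
    change σ.form (σ.sharp β) (σ.sharp α) = 0
    rw [form_swap]
    exact neg_eq_zero.2 (hα.2 β hβ)
  · rintro ⟨⟨α, hα, rfl⟩, h⟩
    refine ⟨α, ⟨hα, fun β hβ => ?_⟩, rfl⟩
    have h1 : σ.form (σ.sharp β) (σ.sharp α) = 0 := h _ ⟨β, hβ, rfl⟩
    rw [poisson, form_swap, h1, neg_zero]

/-- Both sides say that the image `U` of `F` contains `U^σ`: since `dim U^σ = dim V - dim U`, the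
numerical equality means that `U ∩ U^σ` has the full dimension of `U^σ`. -/
theorem finrank_add_finrank_poissonKer_eq_iff (σ : LinearSymplecticForm V)
    (F : Submodule ℝ (Module.Dual ℝ V)) :
    Module.finrank ℝ F + Module.finrank ℝ (σ.poissonKer F) = Module.finrank ℝ V ↔
      ∀ α : Module.Dual ℝ V, (∀ β ∈ F, σ.poisson α β = 0) → α ∈ F := by
  set U := F.map σ.sharpEquiv.toLinearMap with hU
  have h1 : Module.finrank ℝ U = Module.finrank ℝ F := LinearEquiv.finrank_map_eq σ.sharpEquiv F
  have h2 : Module.finrank ℝ (σ.poissonKer F) =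
      Module.finrank ℝ (U ⊓ σ.form.orthogonal U : Submodule ℝ V) := by
    rw [hU, ← map_sharp_poissonKer]
    exact (LinearEquiv.finrank_map_eq σ.sharpEquiv (σ.poissonKer F)).symm
  have h3 := LinearMap.BilinForm.finrank_orthogonal σ.nondegenerate U
  have h4 := Submodule.finrank_le U
  have h5 : (U ⊓ σ.form.orthogonal U : Submodule ℝ V) = σ.form.orthogonal U ↔
      ∀ α : Module.Dual ℝ V, (∀ β ∈ F, σ.poisson α β = 0) → α ∈ F := by
    rw [inf_eq_right]
    constructor
    · intro h α hα
      have : σ.sharp α ∈ U := h <| by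
        rw [LinearMap.BilinForm.mem_orthogonal_iff]
        rintro _ ⟨β, hβ, rfl⟩
        change σ.form (σ.sharp β) (σ.sharp α) = 0
        rw [form_swap]
        exact neg_eq_zero.2 (hα β hβ)
      obtain ⟨β, hβ, hβα⟩ := this
      rwa [← σ.sharpEquiv.injective hβα]
    · intro h v hv
      refine ⟨σ.form v, h _ fun β hβ => ?_, σ.sharp_form v⟩
      have h1 : σ.form (σ.sharp β) v = 0 := hv _ ⟨β, hβ, rfl⟩
      rw [poisson, sharp_form, form_swap, h1, neg_zero]
  rw [← h5, h2, ← h1]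
  constructor
  · intro h
    exact Submodule.eq_of_le_of_finrank_le inf_le_right (by omega)
  · intro h
    rw [h]
    omega

/-- Let `ρ : 𝔤 → V` be a linear map with range `W`. The subspace of the dual space spanned by the
covectors `σ(ρ η, ·)`, `η ∈ a`, and by the annihilator of `W` is coisotropic if and only if every
`ξ` orthogonal to `a` for the form `σ(ρ ·, ρ ·)` agrees with an element of `a` modulo the kernel of
this form. -/
theorem coisotropic_iff (σ : LinearSymplecticForm V) {𝔤 : Type*} [AddCommGroup 𝔤] [Module ℝ 𝔤]
    (ρ : 𝔤 →ₗ[ℝ] V) (a : Submodule ℝ 𝔤) :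
    Module.finrank ℝ (a.map (σ.form ∘ₗ ρ) ⊔ (LinearMap.range ρ).dualAnnihilator :
        Submodule ℝ (Module.Dual ℝ V)) +
      Module.finrank ℝ (σ.poissonKer (a.map (σ.form ∘ₗ ρ) ⊔ (LinearMap.range ρ).dualAnnihilator)) =
        Module.finrank ℝ V ↔
    ∀ ξ, (∀ η ∈ a, σ.form (ρ ξ) (ρ η) = 0) →
      ∃ η ∈ a, ∀ ζ, σ.form (ρ (ξ - η)) (ρ ζ) = 0 := by
  rw [finrank_add_finrank_poissonKer_eq_iff]
  constructor
  · intro h ξ hξ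
    have := h (σ.form (ρ ξ)) (fun β hβ => by
      rw [poisson_form_left]
      obtain ⟨β₁, ⟨η, hη, rfl⟩, β₂, hβ₂, rfl⟩ := Submodule.mem_sup.1 hβ
      have h1 := hξ η hη
      have h2 : β₂ (ρ ξ) = 0 := (Submodule.mem_dualAnnihilator β₂).1 hβ₂ _ ⟨ξ, rfl⟩
      simp only [LinearMap.comp_apply, LinearMap.add_apply]
      rw [h2, σ.form_swap, h1]
      simp)
    obtain ⟨β₁, ⟨η, hη, rfl⟩, β₂, hβ₂, hβ⟩ := Submodule.mem_sup.1 this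
    refine ⟨η, hη, fun ζ => ?_⟩
    have h2 : β₂ (ρ ζ) = 0 := (Submodule.mem_dualAnnihilator β₂).1 hβ₂ _ ⟨ζ, rfl⟩
    have h3 := LinearMap.congr_fun hβ (ρ ζ)
    simp only [LinearMap.comp_apply, LinearMap.add_apply, h2, add_zero] at h3
    rw [map_sub, map_sub, LinearMap.sub_apply, h3, sub_self]
  · intro h α hα
    -- A vector outside the range is detected by a covector annihilating the range; but `α` is
    -- Poisson-orthogonal to all of these.
    have hW : σ.sharp α ∈ LinearMap.range ρ := by
      by_contra hn
      obtain ⟨β, hβ1, hβ2⟩ := Submodule.exists_dual_map_eq_bot_of_notMem hn inferInstance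
      apply hβ1
      have := hα β (Submodule.mem_sup_right ((Submodule.mem_dualAnnihilator β).2 fun w hw => by
        have : β w ∈ (LinearMap.range ρ).map β := ⟨w, hw, rfl⟩
        rwa [hβ2, Submodule.mem_bot] at this))
      rwa [σ.form_eq_of_sharp_eq (α := α) rfl, poisson_form_left, neg_eq_zero] at this
    obtain ⟨ξ, hξ⟩ := hW
    have hαξ : α = σ.form (ρ ξ) := σ.form_eq_of_sharp_eq hξ.symm
    subst hαξ
    obtain ⟨η, hη, hζ⟩ := h ξ fun η hη => by
      have := hα (σ.form (ρ η)) (Submodule.mem_sup_left ⟨η, hη, rfl⟩)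
      rw [poisson_form_left, neg_eq_zero, form_swap, neg_eq_zero] at this
      exact this
    refine Submodule.mem_sup.2 ⟨σ.form (ρ η), ⟨η, hη, rfl⟩, σ.form (ρ (ξ - η)), ?_, ?_⟩
    · rw [Submodule.mem_dualAnnihilator]
      rintro _ ⟨ζ, rfl⟩
      exact hζ ζ
    · rw [map_sub, map_sub, add_sub_cancel]

theorem poisson_add_left (σ : LinearSymplecticForm V) (α α' β : Module.Dual ℝ V) :
    σ.poisson (α + α') β = σ.poisson α β + σ.poisson α' β := by
  simp [poisson, sharp]

theorem poisson_smul_left (σ : LinearSymplecticForm V) (c : ℝ) (α β : Module.Dual ℝ V) :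
    σ.poisson (c • α) β = c * σ.poisson α β := by
  simp [poisson, sharp]

theorem poisson_add_right (σ : LinearSymplecticForm V) (α β β' : Module.Dual ℝ V) :
    σ.poisson α (β + β') = σ.poisson α β + σ.poisson α β' := by
  simp [poisson, sharp]

theorem poisson_smul_right (σ : LinearSymplecticForm V) (c : ℝ) (α β : Module.Dual ℝ V) :
    σ.poisson α (c • β) = c * σ.poisson α β := by
  simp [poisson, sharp]

/-- The rank of the Poisson structure on the span of a family of covectors is the rank of the
(possibly infinite) matrix of the Poisson brackets of the family. -/
theorem finrank_eq_finrank_span_poisson_add (σ : LinearSymplecticForm V) {κ : Type*}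
    (d : κ → Module.Dual ℝ V) :
    Module.finrank ℝ (Submodule.span ℝ (Set.range d)) =
      Module.finrank ℝ (Submodule.span ℝ (Set.range fun i : κ => fun j : κ =>
        σ.poisson (d i) (d j))) +
      Module.finrank ℝ (σ.poissonKer (Submodule.span ℝ (Set.range d))) := by
  set F := Submodule.span ℝ (Set.range d) with hF
  -- On `F`, the image of `L` is the row space of the matrix of brackets and its kernel is the
  -- Poisson kernel, so rank-nullity gives the claim.
  let L : Module.Dual ℝ V →ₗ[ℝ] κ → ℝ :=
    { toFun := fun α j => σ.poisson α (d j)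
      map_add' := fun α β => by ext j; simp [poisson_add_left]
      map_smul' := fun c α => by ext j; simp [poisson_smul_left] }
  have hrange : LinearMap.range (L.domRestrict F) =
      Submodule.span ℝ (Set.range fun i : κ => fun j : κ => σ.poisson (d i) (d j)) := by
    rw [LinearMap.range_domRestrict, hF, Submodule.map_span, ← Set.range_comp]
    rfl
  have hker : (LinearMap.ker (L.domRestrict F)).map F.subtype = σ.poissonKer F := by
    ext α
    simp only [Submodule.mem_map, LinearMap.mem_ker, Submodule.subtype_apply]
    constructor
    · rintro ⟨⟨α, hα⟩, h, rfl⟩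
      refine ⟨hα, fun β hβ => ?_⟩
      induction hβ using Submodule.span_induction with
      | mem β hβ =>
        obtain ⟨j, rfl⟩ := hβ
        exact congrFun h j
      | zero => simp [poisson, sharp]
      | add β β' _ _ h1 h2 => simpa [poisson_add_right, h1] using h2
      | smul c β _ h1 => simp only [poisson_smul_right]; simp only at h1; rw [h1, mul_zero]
    · intro h
      exact ⟨⟨α, h.1⟩, funext fun j => h.2 _ (Submodule.subset_span ⟨j, rfl⟩), rfl⟩
  have h1 := LinearMap.finrank_range_add_finrank_ker (K := ℝ) (V := F) (V₂ := κ → ℝ) (L.domRestrict F)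
  have h2 := LinearEquiv.finrank_eq
    (Submodule.equivMapOfInjective F.subtype F.injective_subtype (LinearMap.ker (L.domRestrict F)))
  rw [hker] at h2
  rw [hrange, h2] at h1
  exact h1.symm

end LinearSymplecticForm

/-! ### Lower semicontinuity of ranks -/

/-- A linearly independent finite family of functions stays so after restriction to a suitable
finite set. -/
theorem LinearIndependent.exists_finset_restrict {ι κ : Type*} [Finite ι] {v : ι → κ → ℝ}
    (hv : LinearIndependent ℝ v) :
    ∃ T : Finset κ, LinearIndependent ℝ fun i => fun j : T => v i j := by
  classical
  cases nonempty_fintype ι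
  let K : κ → Submodule ℝ (ι → ℝ) := fun j =>
    LinearMap.ker (Fintype.linearCombination ℝ fun i => v i j)
  -- `K j` consists of the relations valid in the coordinate `j`. By the descending chain condition
  -- in `ι → ℝ`, finitely many coordinates impose all of them.
  obtain ⟨T, hT⟩ := Finset.exists_inf_le K
  refine ⟨T, Fintype.linearIndependent_iff.2 fun c hc => ?_⟩
  have hcT : c ∈ T.inf K := by
    rw [Submodule.mem_finsetInf]
    intro j hj
    simpa [K, Fintype.linearCombination_apply] using congrFun hc ⟨j, hj⟩
  refine Fintype.linearIndependent_iff.1 hv c (funext fun j => ?_)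
  simpa [K, Fintype.linearCombination_apply] using hT j hcT

/-- Linear independence of finitely many vectors is an open condition once they are truncated to a
finite set of coordinates that witnesses it at `x₀`. The finiteness hypothesis excludes the value
`0` that `finrank` takes on infinite-dimensional spaces. -/
theorem eventually_le_finrank_span_pi {X κ ι : Type*} [TopologicalSpace X] {s : ι → X → κ → ℝ}
    (hs : ∀ i j, Continuous fun x => s i x j)
    (hfin : ∀ x, FiniteDimensional ℝ (Submodule.span ℝ (Set.range fun i => s i x))) (x₀ : X) :
    ∀ᶠ x in 𝓝 x₀, Module.finrank ℝ (Submodule.span ℝ (Set.range fun i => s i x₀)) ≤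
      Module.finrank ℝ (Submodule.span ℝ (Set.range fun i => s i x)) := by
  classical
  obtain ⟨f, hf, -, hli⟩ := Submodule.exists_fun_fin_finrank_span_eq ℝ (Set.range fun i => s i x₀)
  choose a ha using hf
  obtain ⟨T, hT⟩ := hli.exists_finset_restrict
  have hc : Continuous fun x => fun (k : Fin _) (j : T) => s (a k) x j :=
    continuous_pi fun k => continuous_pi fun j => hs _ _
  have h0 : (fun (k : Fin _) (j : T) => s (a k) x₀ j) = fun k (j : T) => f k j := by
    funext k j
    rw [← ha k]
  have hev := (hc.tendsto x₀).eventually (p := fun w => LinearIndependent ℝ w)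
    (by rw [h0]; exact hT.eventually)
  filter_upwards [hev] with x hx
  have hx' : LinearIndependent ℝ fun k => s (a k) x :=
    LinearIndependent.of_comp (LinearMap.funLeft ℝ ℝ ((↑) : T → κ)) hx
  have := hfin x
  have hmem : ∀ k, s (a k) x ∈ Submodule.span ℝ (Set.range fun i => s i x) := fun k =>
    Submodule.subset_span ⟨a k, rfl⟩
  have hx'' : LinearIndependent ℝ fun k => (⟨s (a k) x, hmem k⟩ :
      Submodule.span ℝ (Set.range fun i => s i x)) :=
    LinearIndependent.of_comp (Submodule.subtype _) hx'
  simpa using hx''.fintype_card_le_finrank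

theorem eventually_le_finrank_span {X ι W : Type*} [TopologicalSpace X] [NormedAddCommGroup W]
    [NormedSpace ℝ W] [FiniteDimensional ℝ W] {s : ι → X → W} (hs : ∀ i, Continuous (s i))
    (x₀ : X) :
    ∀ᶠ x in 𝓝 x₀, Module.finrank ℝ (Submodule.span ℝ (Set.range fun i => s i x₀)) ≤
      Module.finrank ℝ (Submodule.span ℝ (Set.range fun i => s i x)) := by
  obtain ⟨f, hf, -, hli⟩ := Submodule.exists_fun_fin_finrank_span_eq ℝ (Set.range fun i => s i x₀)
  choose a ha using hf
  have hc : Continuous fun x => fun (k : Fin _) => s (a k) x := continuous_pi fun k => hs _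
  have h0 : (fun (k : Fin _) => s (a k) x₀) = f := funext ha
  have hev := (hc.tendsto x₀).eventually (p := fun w => LinearIndependent ℝ w)
    (by rw [h0]; exact hli.eventually)
  filter_upwards [hev] with x hx
  have hmem : ∀ k, s (a k) x ∈ Submodule.span ℝ (Set.range fun i => s i x) := fun k =>
    Submodule.subset_span ⟨a k, rfl⟩
  have hx' : LinearIndependent ℝ fun k => (⟨s (a k) x, hmem k⟩ :
      Submodule.span ℝ (Set.range fun i => s i x)) :=
    LinearIndependent.of_comp (Submodule.subtype _) hx
  simpa using hx'.fintype_card_le_finrank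

/-- Lower semicontinuous functions with values in a bounded set of natural numbers are locally
constant at the points of an open dense set. -/
theorem dense_setOf_eventually_eq {X : Type*} [TopologicalSpace X] {f : X → ℕ} {b : ℕ}
    (hb : ∀ x, f x ≤ b) (hf : ∀ x₀, ∀ᶠ x in 𝓝 x₀, f x₀ ≤ f x) :
    Dense {x₀ | ∀ᶠ x in 𝓝 x₀, f x = f x₀} := by
  rw [dense_iff_inter_open]
  rintro U hU ⟨y, hy⟩
  have hne : (f '' U).Nonempty := ⟨_, y, hy, rfl⟩
  have hbd : BddAbove (f '' U) := ⟨b, by rintro _ ⟨x, -, rfl⟩; exact hb x⟩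
  -- Where the maximum over `U` is attained, semicontinuity prevents nearby values from being
  -- smaller.
  obtain ⟨x₀, hx₀, hmax⟩ := Nat.sSup_mem hne hbd
  refine ⟨x₀, hx₀, ?_⟩
  filter_upwards [hf x₀, hU.mem_nhds hx₀] with x h1 h2
  exact le_antisymm (hmax ▸ le_csSup hbd ⟨x, h2, rfl⟩) h1

theorem isOpen_setOf_eventually_eq {X Y : Type*} [TopologicalSpace X] {f : X → Y} :
    IsOpen {x₀ | ∀ᶠ x in 𝓝 x₀, f x = f x₀} := by
  rw [isOpen_iff_mem_nhds]
  intro x₀ hx₀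
  have h1 := hx₀.eventually_nhds
  filter_upwards [h1, hx₀] with x h2 h3
  filter_upwards [h2] with y hy
  rw [hy, h3]

/-! ### Pointwise completeness -/

section Pointwise

variable {𝔤₀ : Type*} [NormedAddCommGroup 𝔤₀] [NormedSpace ℝ 𝔤₀] [FiniteDimensional ℝ 𝔤₀]
  (G : Type*) [TopologicalSpace G] [ChartedSpace 𝔤₀ G] [Group G] [LieGroup 𝓘(ℝ, 𝔤₀) ∞ G]

/-- The subspace of the Lie algebra spanned by the differentials at `μ` of the functions in `A`. -/
def gradSpan {𝔤₀ : Type*} [NormedAddCommGroup 𝔤₀] [NormedSpace ℝ 𝔤₀] [FiniteDimensional ℝ 𝔤₀]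
    (A : Submodule ℝ ((𝔤₀ →L[ℝ] ℝ) → ℝ)) (μ : 𝔤₀ →L[ℝ] ℝ) : Submodule ℝ 𝔤₀ :=
  Submodule.span ℝ (Set.range fun h : A => dualGrad h.1 μ)

/-- The differentials at `μ` of the functions in `A` span a coisotropic subspace for the
Lie-Poisson structure, modulo the annihilator of the tangent space to the coadjoint orbit. -/
def IsCoisotropicAt (A : Submodule ℝ ((𝔤₀ →L[ℝ] ℝ) → ℝ)) (μ : 𝔤₀ →L[ℝ] ℝ) : Prop :=
  ∀ ξ, (∀ η ∈ gradSpan A μ, μ (lieBr G ξ η) = 0) →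
    ∃ η ∈ gradSpan A μ, ∀ ζ, μ (lieBr G (ξ - η) ζ) = 0

/-- The infinitesimal coadjoint action as a map onto the tangent space of the orbit. -/
def orbitProj (ν : 𝔤₀ →L[ℝ] ℝ) : 𝔤₀ →ₗ[ℝ] orbitTangent G ν :=
  (adStar G ν).rangeRestrict

theorem range_orbitProj (ν : 𝔤₀ →L[ℝ] ℝ) : LinearMap.range (orbitProj G ν) = ⊤ :=
  LinearMap.range_rangeRestrict _

theorem orbitSymplectic_form_orbitProj (ν : 𝔤₀ →L[ℝ] ℝ) (ξ η : 𝔤₀) :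
    (orbitSymplectic G ν).form (orbitProj G ν ξ) (orbitProj G ν η) =
      ν (lieBr G ξ η) :=
  orbitForm_apply G ν ξ η

/-- The Hamiltonian vector of `h` on the orbit is `ad*_ξ ν` with `ξ = dh(ν)`. -/
theorem orbitDifferential_eq (h : (𝔤₀ →L[ℝ] ℝ) → ℝ) (ν : 𝔤₀ →L[ℝ] ℝ) :
    orbitDifferential G h ν =
      (orbitSymplectic G ν).form (orbitProj G ν (dualGrad h ν)) := by
  apply LinearMap.ext
  rintro ⟨u, ξ, rfl⟩
  have h1 := orbitSymplectic_form_orbitProj G ν (dualGrad h ν) ξ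
  refine Eq.trans ?_ h1.symm
  change fderiv ℝ h ν (adStar G ν ξ) = _
  rw [← apply_dualGrad, adStar_apply, lieBr_skew, map_neg, neg_neg]

theorem poisson_orbitDifferential (h₁ h₂ : (𝔤₀ →L[ℝ] ℝ) → ℝ) (ν : 𝔤₀ →L[ℝ] ℝ) :
    (orbitSymplectic G ν).poisson (orbitDifferential G h₁ ν) (orbitDifferential G h₂ ν) =
      liePoisson G h₁ h₂ ν := by
  rw [orbitDifferential_eq, orbitDifferential_eq, LinearSymplecticForm.poisson,
    LinearSymplecticForm.sharp_form, LinearSymplecticForm.sharp_form,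
    orbitSymplectic_form_orbitProj, liePoisson]

theorem orbitDiffSpan_eq_span_range (A : Submodule ℝ ((𝔤₀ →L[ℝ] ℝ) → ℝ)) (ν : 𝔤₀ →L[ℝ] ℝ) :
    orbitDiffSpan G A ν = Submodule.span ℝ (Set.range fun h : A => orbitDifferential G h.1 ν) := by
  rw [orbitDiffSpan]
  congr 1
  ext α
  simp

theorem orbitDiffSpan_eq_map (A : Submodule ℝ ((𝔤₀ →L[ℝ] ℝ) → ℝ)) (ν : 𝔤₀ →L[ℝ] ℝ) :
    orbitDiffSpan G A ν =
      (gradSpan A ν).map ((orbitSymplectic G ν).form ∘ₗ orbitProj G ν) := by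
  rw [orbitDiffSpan_eq_span_range, gradSpan, Submodule.map_span, ← Set.range_comp]
  congr 2
  funext h
  exact orbitDifferential_eq G h.1 ν

/-- The linear criterion for the infinitesimal coadjoint action; this map is onto the tangent space
of the orbit, so the annihilator summand vanishes. -/
theorem orbit_coisotropic_iff (A : Submodule ℝ ((𝔤₀ →L[ℝ] ℝ) → ℝ)) (ν : 𝔤₀ →L[ℝ] ℝ) :
    Module.finrank ℝ (orbitDiffSpan G A ν) +
      Module.finrank ℝ ((orbitSymplectic G ν).poissonKer (orbitDiffSpan G A ν)) =
        Module.finrank ℝ (orbitTangent G ν) ↔ IsCoisotropicAt G A ν := by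
  have h1 := (orbitSymplectic G ν).coisotropic_iff (orbitProj G ν) (gradSpan A ν)
  have h2 : (LinearMap.range (orbitProj G ν)).dualAnnihilator = ⊥ := by
    rw [range_orbitProj, Submodule.dualAnnihilator_top]
  rw [h2, sup_bot_eq, ← orbitDiffSpan_eq_map] at h1
  simp only [orbitSymplectic_form_orbitProj] at h1
  exact h1

/-! #### Lower semicontinuity of the dimensions on the dual of the Lie algebra -/

/-- The rank of the Poisson structure on the differentials of the functions in `A`. -/
def orbitPoissonRank (A : Submodule ℝ ((𝔤₀ →L[ℝ] ℝ) → ℝ)) (ν : 𝔤₀ →L[ℝ] ℝ) : ℕ :=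
  Module.finrank ℝ (Submodule.span ℝ (Set.range fun h : A => fun h' : A =>
    liePoisson G h.1 h'.1 ν))

/-- The kernel dimension need not be semicontinuous. This writes it as a difference of two lower
semicontinuous quantities. -/
theorem finrank_orbitDiffSpan_eq_rank_add (A : Submodule ℝ ((𝔤₀ →L[ℝ] ℝ) → ℝ))
    (ν : 𝔤₀ →L[ℝ] ℝ) :
    Module.finrank ℝ (orbitDiffSpan G A ν) = orbitPoissonRank G A ν +
      Module.finrank ℝ ((orbitSymplectic G ν).poissonKer (orbitDiffSpan G A ν)) := by
  have h := (orbitSymplectic G ν).finrank_eq_finrank_span_poisson_add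
    fun h : A => orbitDifferential G h.1 ν
  rw [← orbitDiffSpan_eq_span_range] at h
  rw [h, orbitPoissonRank]
  have key : (fun h₁ h₂ : A => (orbitSymplectic G ν).poisson (orbitDifferential G h₁.1 ν)
      (orbitDifferential G h₂.1 ν)) = fun h₁ h₂ : A => liePoisson G h₁.1 h₂.1 ν :=
    funext fun h₁ => funext fun h₂ => poisson_orbitDifferential G h₁.1 h₂.1 ν
  rw [key]

/-- The cotangent spaces of the orbits vary with `ν`; passing to Hamiltonian vectors places the span
in the fixed space `𝔤*`, where continuity makes sense. -/
theorem finrank_orbitDiffSpan (A : Submodule ℝ ((𝔤₀ →L[ℝ] ℝ) → ℝ)) (ν : 𝔤₀ →L[ℝ] ℝ) :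
    Module.finrank ℝ (orbitDiffSpan G A ν) = Module.finrank ℝ
      (Submodule.span ℝ (Set.range fun h : A => adStar G ν (dualGrad h.1 ν))) := by
  have h1 : orbitDiffSpan G A ν =
      ((gradSpan A ν).map (orbitProj G ν)).map (orbitSymplectic G ν).sharpEquiv.symm.toLinearMap := by
    rw [orbitDiffSpan_eq_map, Submodule.map_comp]
    rfl
  have h2 : Submodule.span ℝ (Set.range fun h : A => adStar G ν (dualGrad h.1 ν)) =
      ((gradSpan A ν).map (orbitProj G ν)).map (orbitTangent G ν).subtype := by
    rw [← Submodule.map_comp, gradSpan, Submodule.map_span, ← Set.range_comp]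
    rfl
  rw [h1, h2, LinearEquiv.finrank_map_eq]
  exact (LinearEquiv.finrank_eq (Submodule.equivMapOfInjective _
    (orbitTangent G ν).injective_subtype ((gradSpan A ν).map (orbitProj G ν))))

omit G in
theorem continuous_dualGrad {h : (𝔤₀ →L[ℝ] ℝ) → ℝ} (hh : ContDiff ℝ ∞ h) :
    Continuous (dualGrad h) := by
  let L : ((𝔤₀ →L[ℝ] ℝ) →L[ℝ] ℝ) →ₗ[ℝ] 𝔤₀ :=
    { toFun := fun φ => (Module.evalEquiv ℝ 𝔤₀).symm (φ.toLinearMap ∘ₗ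
        (LinearMap.toContinuousLinearMap (𝕜 := ℝ) (E := 𝔤₀)).toLinearMap)
      map_add' := fun φ ψ => by rw [← map_add]; rfl
      map_smul' := fun c φ => by rw [RingHom.id_apply, ← map_smul]; rfl }
  exact L.continuous_of_finiteDimensional.comp (hh.continuous_fderiv (by simp))

theorem continuous_adStar_apply {X : Type*} [TopologicalSpace X] {ν : X → 𝔤₀ →L[ℝ] ℝ}
    {ξ : X → 𝔤₀} (hν : Continuous ν) (hξ : Continuous ξ) :
    Continuous fun x => adStar G (ν x) (ξ x) := by
  let L : 𝔤₀ →ₗ[ℝ] (𝔤₀ →L[ℝ] 𝔤₀) :=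
    (LinearMap.toContinuousLinearMap (𝕜 := ℝ) (E := 𝔤₀) (F' := 𝔤₀)).toLinearMap ∘ₗ lieBr G
  have hL : Continuous fun x => L (ξ x) := L.continuous_of_finiteDimensional.comp hξ
  exact (hν.clm_comp hL).neg

theorem continuous_liePoisson {h₁ h₂ : (𝔤₀ →L[ℝ] ℝ) → ℝ} (hh₁ : ContDiff ℝ ∞ h₁)
    (hh₂ : ContDiff ℝ ∞ h₂) : Continuous (liePoisson G h₁ h₂) := by
  have h := (continuous_adStar_apply G continuous_id (continuous_dualGrad hh₁)).clm_apply
    (continuous_dualGrad hh₂)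
  refine h.neg.congr fun μ => ?_
  simp [adStar_apply, liePoisson]

theorem eventually_finrank_orbitTangent_le (ν₀ : 𝔤₀ →L[ℝ] ℝ) :
    ∀ᶠ ν in 𝓝 ν₀, Module.finrank ℝ (orbitTangent G ν₀) ≤ Module.finrank ℝ (orbitTangent G ν) := by
  have h (ν : 𝔤₀ →L[ℝ] ℝ) : Module.finrank ℝ (orbitTangent G ν) =
      Module.finrank ℝ (Submodule.span ℝ (Set.range fun ξ : 𝔤₀ => adStar G ν ξ)) := by
    rw [show Submodule.span ℝ (Set.range fun ξ : 𝔤₀ => adStar G ν ξ) = orbitTangent G ν from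
      Submodule.span_eq (orbitTangent G ν)]
  simp only [h]
  exact eventually_le_finrank_span (s := fun (ξ : 𝔤₀) ν => adStar G ν ξ)
    (fun ξ => continuous_adStar_apply G continuous_id continuous_const) ν₀

variable {A : Submodule ℝ ((𝔤₀ →L[ℝ] ℝ) → ℝ)}

theorem eventually_finrank_orbitDiffSpan_le (hA : ∀ h ∈ A, ContDiff ℝ ∞ h) (ν₀ : 𝔤₀ →L[ℝ] ℝ) :
    ∀ᶠ ν in 𝓝 ν₀,
      Module.finrank ℝ (orbitDiffSpan G A ν₀) ≤ Module.finrank ℝ (orbitDiffSpan G A ν) := by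
  simp only [finrank_orbitDiffSpan]
  exact eventually_le_finrank_span (s := fun (h : A) ν => adStar G ν (dualGrad h.1 ν))
    (fun h => continuous_adStar_apply G continuous_id (continuous_dualGrad (hA h.1 h.2))) ν₀

theorem eventually_orbitPoissonRank_le (hA : ∀ h ∈ A, ContDiff ℝ ∞ h) (ν₀ : 𝔤₀ →L[ℝ] ℝ) :
    ∀ᶠ ν in 𝓝 ν₀, orbitPoissonRank G A ν₀ ≤ orbitPoissonRank G A ν := by
  refine eventually_le_finrank_span_pi (s := fun (h : A) ν => fun h' : A => liePoisson G h.1 h'.1 ν)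
    (fun h h' => continuous_liePoisson G (hA h.1 h.2) (hA h'.1 h'.2)) (fun ν => ?_) ν₀
  -- The rows of the bracket matrix are images of elements of `𝔤`, so they span a finite-dimensional
  -- space even when `A` is infinite-dimensional.
  let L : 𝔤₀ →ₗ[ℝ] (A → ℝ) := LinearMap.pi fun h' =>
    { toFun := fun ξ => ν (lieBr G ξ (dualGrad h'.1 ν))
      map_add' := fun ξ η => by simp
      map_smul' := fun c ξ => by simp }
  have : Submodule.span ℝ (Set.range fun h : A => fun h' : A => liePoisson G h.1 h'.1 ν) =
      (gradSpan A ν).map L := by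
    rw [gradSpan, Submodule.map_span, ← Set.range_comp]
    rfl
  rw [this]
  infer_instance

/-- The triple of the dimension of the span of the differentials of `A` along the coadjoint
orbit, the rank of the Poisson structure on it, and the dimension of the orbit. -/
def orbitRanks (A : Submodule ℝ ((𝔤₀ →L[ℝ] ℝ) → ℝ)) (ν : 𝔤₀ →L[ℝ] ℝ) : ℕ × ℕ × ℕ :=
  (Module.finrank ℝ (orbitDiffSpan G A ν), orbitPoissonRank G A ν,
    Module.finrank ℝ (orbitTangent G ν))

theorem dense_setOf_orbitRanks_eventually_eq (hA : ∀ h ∈ A, ContDiff ℝ ∞ h)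
    (S : Set (𝔤₀ →L[ℝ] ℝ)) :
    Dense {μ₀ : S | ∀ᶠ μ in 𝓝 μ₀, orbitRanks G A μ.1 = orbitRanks G A μ₀.1} := by
  have hev (μ₀ : S) := (continuous_subtype_val.tendsto μ₀).eventually
    ((eventually_finrank_orbitDiffSpan_le G hA μ₀.1).and
      ((eventually_orbitPoissonRank_le G hA μ₀.1).and
        (eventually_finrank_orbitTangent_le G μ₀.1)))
  -- If a sum of lower semicontinuous integer functions is locally constant, so is each summand;
  -- hence one application to the sum suffices.
  refine (dense_setOf_eventually_eq (X := S) (f := fun μ =>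
    Module.finrank ℝ (orbitDiffSpan G A μ.1) + orbitPoissonRank G A μ.1 +
      Module.finrank ℝ (orbitTangent G μ.1))
    (b := 3 * Module.finrank ℝ (𝔤₀ →L[ℝ] ℝ)) (fun μ => ?_) (fun μ₀ => ?_)).mono ?_
  · have h1 := finrank_orbitDiffSpan_eq_rank_add G A μ.1
    have h2 : Module.finrank ℝ (orbitDiffSpan G A μ.1) ≤ Module.finrank ℝ (𝔤₀ →L[ℝ] ℝ) := by
      rw [finrank_orbitDiffSpan]
      exact Submodule.finrank_le _
    have h3 := Submodule.finrank_le (orbitTangent G μ.1)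
    omega
  · filter_upwards [hev μ₀] with μ hμ
    omega
  · intro μ₀ hμ₀
    filter_upwards [hμ₀, hev μ₀] with μ h1 h2
    simp only [orbitRanks, Prod.mk.injEq]
    omega

theorem isCoisotropicAt_iff_of_orbitRanks_eq {μ ν : 𝔤₀ →L[ℝ] ℝ}
    (h : orbitRanks G A μ = orbitRanks G A ν) :
    IsCoisotropicAt G A μ ↔ IsCoisotropicAt G A ν := by
  rw [← orbit_coisotropic_iff, ← orbit_coisotropic_iff]
  simp only [orbitRanks, Prod.mk.injEq] at h
  have h1 := finrank_orbitDiffSpan_eq_rank_add G A μ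
  have h2 := finrank_orbitDiffSpan_eq_rank_add G A ν
  omega

end Pointwise

/-! ### Differentials on a Hamiltonian manifold -/

section Hamiltonian

variable {𝔤₀ : Type*} [NormedAddCommGroup 𝔤₀] [NormedSpace ℝ 𝔤₀] [FiniteDimensional ℝ 𝔤₀]
  {G : Type*} [TopologicalSpace G] [ChartedSpace 𝔤₀ G] [Group G] [LieGroup 𝓘(ℝ, 𝔤₀) ∞ G]
  {E : Type*} [NormedAddCommGroup E] [NormedSpace ℝ E] [FiniteDimensional ℝ E]
  {M : Type*} [TopologicalSpace M] [ChartedSpace E M] [MulAction G M]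
  {σ : SymplecticForm E M} {Φ : M → (𝔤₀ →L[ℝ] ℝ)}

omit [FiniteDimensional ℝ E] in
theorem differential_add {f g : M → ℝ} {x : M} (hf : MDifferentiableAt 𝓘(ℝ, E) 𝓘(ℝ, ℝ) f x)
    (hg : MDifferentiableAt 𝓘(ℝ, E) 𝓘(ℝ, ℝ) g x) :
    differential E (f + g) x = differential E f x + differential E g x := by
  have := (hf.hasMFDerivAt.add hg.hasMFDerivAt).mfderiv
  rw [differential, this]
  rfl

omit [FiniteDimensional ℝ E] in
theorem diffSpan_sup {F₁ F₂ : Submodule ℝ (M → ℝ)}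
    (h₁ : ∀ f ∈ F₁, ContMDiff 𝓘(ℝ, E) 𝓘(ℝ, ℝ) ∞ f) (h₂ : ∀ f ∈ F₂, ContMDiff 𝓘(ℝ, E) 𝓘(ℝ, ℝ) ∞ f)
    (x : M) : diffSpan E (F₁ ⊔ F₂) x = diffSpan E F₁ x ⊔ diffSpan E F₂ x := by
  apply le_antisymm
  · rw [diffSpan, Submodule.span_le]
    rintro _ ⟨f, hf, rfl⟩
    obtain ⟨f₁, hf₁, f₂, hf₂, rfl⟩ := Submodule.mem_sup.1 hf
    rw [differential_add ((h₁ f₁ hf₁).mdifferentiable (by simp) x)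
      ((h₂ f₂ hf₂).mdifferentiable (by simp) x)]
    exact Submodule.add_mem_sup (Submodule.subset_span ⟨f₁, hf₁, rfl⟩)
      (Submodule.subset_span ⟨f₂, hf₂, rfl⟩)
  · refine sup_le (Submodule.span_mono ?_) (Submodule.span_mono ?_)
    · rintro _ ⟨f, hf, rfl⟩
      exact ⟨f, Submodule.mem_sup_left hf, rfl⟩
    · rintro _ ⟨f, hf, rfl⟩
      exact ⟨f, Submodule.mem_sup_right hf, rfl⟩

namespace IsHamiltonianAction

theorem form_infAction (hΦ : IsHamiltonianAction G σ Φ) (x : M) (ξ : 𝔤₀)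
    (v : TangentSpace 𝓘(ℝ, E) x) :
    (σ.at_ x).form (infAction 𝔤₀ E G x ξ) v = differential E (fun y => Φ y ξ) x v := by
  rw [← hΦ.generates, SymplecticForm.sgrad, LinearSymplecticForm.form_sharp]

/-- The bridge between `M` and `𝔤*`: along the `G`-orbits, `σ` is determined by the value of the
moment map. -/
theorem form_infAction_infAction (hΦ : IsHamiltonianAction G σ Φ) (x : M) (ξ η : 𝔤₀) :
    (σ.at_ x).form (infAction 𝔤₀ E G x ξ) (infAction 𝔤₀ E G x η) = Φ x (lieBr G ξ η) := by
  rw [hΦ.bracket, SymplecticForm.bracket, hΦ.generates, hΦ.generates]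

/-- The derivative of the moment map. -/
def dMoment (E : Type*) [NormedAddCommGroup E] [NormedSpace ℝ E] {M : Type*} [TopologicalSpace M]
    [ChartedSpace E M] (Φ : M → (𝔤₀ →L[ℝ] ℝ)) (x : M) :
    TangentSpace 𝓘(ℝ, E) x →L[ℝ] (𝔤₀ →L[ℝ] ℝ) :=
  mfderiv 𝓘(ℝ, E) 𝓘(ℝ, 𝔤₀ →L[ℝ] ℝ) Φ x

theorem differential_comp (hΦ : IsHamiltonianAction G σ Φ) {h : (𝔤₀ →L[ℝ] ℝ) → ℝ}
    (x : M) (hh : DifferentiableAt ℝ h (Φ x)) (v : TangentSpace 𝓘(ℝ, E) x) :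
    differential E (h ∘ Φ) x v = fderiv ℝ h (Φ x) (dMoment E Φ x v) := by
  have h1 := HasMFDerivAt.comp x hh.hasFDerivAt.hasMFDerivAt
    (hΦ.smooth_moment.mdifferentiable (by simp) x).hasMFDerivAt
  rw [differential, h1.mfderiv]
  rfl

theorem dMoment_apply (hΦ : IsHamiltonianAction G σ Φ) (x : M) (ξ : 𝔤₀)
    (v : TangentSpace 𝓘(ℝ, E) x) :
    dMoment E Φ x v ξ = (σ.at_ x).form (infAction 𝔤₀ E G x ξ) v := by
  rw [hΦ.form_infAction]
  have h := hΦ.differential_comp (h := fun μ : 𝔤₀ →L[ℝ] ℝ => μ ξ) x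
    (ContinuousLinearMap.apply ℝ ℝ ξ).differentiableAt v
  refine Eq.trans ?_ h.symm
  rw [show (fun μ : 𝔤₀ →L[ℝ] ℝ => μ ξ) = ContinuousLinearMap.apply ℝ ℝ ξ from rfl,
    ContinuousLinearMap.fderiv]
  rfl

/-- To first order at `x`, `h ∘ Φ` behaves like `f_ξ` with `ξ = dh(Φ x)` held fixed. -/
theorem differential_comp_eq_form (hΦ : IsHamiltonianAction G σ Φ) {h : (𝔤₀ →L[ℝ] ℝ) → ℝ}
    (x : M) (hh : DifferentiableAt ℝ h (Φ x)) :
    differential E (h ∘ Φ) x = (σ.at_ x).form (infAction 𝔤₀ E G x (dualGrad h (Φ x))) := by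
  apply LinearMap.ext
  intro v
  rw [hΦ.differential_comp x hh, ← apply_dualGrad, hΦ.dMoment_apply]

theorem sgrad_comp (hΦ : IsHamiltonianAction G σ Φ) {h : (𝔤₀ →L[ℝ] ℝ) → ℝ}
    (x : M) (hh : DifferentiableAt ℝ h (Φ x)) :
    σ.sgrad (h ∘ Φ) x = infAction 𝔤₀ E G x (dualGrad h (Φ x)) := by
  rw [SymplecticForm.sgrad, hΦ.differential_comp_eq_form x hh, LinearSymplecticForm.sharp_form]

theorem diffSpan_pullback (hΦ : IsHamiltonianAction G σ Φ) {A : Submodule ℝ ((𝔤₀ →L[ℝ] ℝ) → ℝ)}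
    (hA : ∀ h ∈ A, ContDiff ℝ ∞ h) (x : M) :
    diffSpan E (pullback Φ A) x =
      (gradSpan A (Φ x)).map ((σ.at_ x).form ∘ₗ (infAction 𝔤₀ E G x).toLinearMap) := by
  rw [gradSpan, Submodule.map_span, ← Set.range_comp, diffSpan]
  congr 1
  ext α
  have key (h : A) : differential E (h.1 ∘ Φ) x =
      (σ.at_ x).form (infAction 𝔤₀ E G x (dualGrad h.1 (Φ x))) :=
    hΦ.differential_comp_eq_form x ((hA h.1 h.2).differentiable (by simp) _)
  constructor
  · rintro ⟨_, ⟨h, hh, rfl⟩, rfl⟩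
    exact ⟨⟨h, hh⟩, (key ⟨h, hh⟩).symm⟩
  · rintro ⟨h, rfl⟩
    exact ⟨h.1 ∘ Φ, ⟨h.1, h.2, rfl⟩, key h⟩

omit [LieGroup 𝓘(ℝ, 𝔤₀) ∞ G] [FiniteDimensional ℝ E] [FiniteDimensional ℝ 𝔤₀] [MulAction G M] in
theorem contMDiff_of_mem_pullback (hΦ : ContMDiff 𝓘(ℝ, E) 𝓘(ℝ, 𝔤₀ →L[ℝ] ℝ) ∞ Φ)
    {A : Submodule ℝ ((𝔤₀ →L[ℝ] ℝ) → ℝ)}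
    (hA : ∀ h ∈ A, ContDiff ℝ ∞ h) : ∀ f ∈ pullback Φ A, ContMDiff 𝓘(ℝ, E) 𝓘(ℝ, ℝ) ∞ f := by
  rintro _ ⟨h, hh, rfl⟩
  exact (hA h hh).contMDiff.comp hΦ

omit [LieGroup 𝓘(ℝ, 𝔤₀) ∞ G] [FiniteDimensional ℝ E] [FiniteDimensional ℝ 𝔤₀] [ChartedSpace 𝔤₀ G]
  [TopologicalSpace G] in
theorem contMDiff_of_mem_invariantFunctions :
    ∀ f ∈ invariantFunctions E G M, ContMDiff 𝓘(ℝ, E) 𝓘(ℝ, ℝ) ∞ f :=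
  fun _ hf => And.left hf

/-- Completeness at a point `x` at which the differentials of the invariants span the annihilator
of the orbit is equivalent to completeness on the coadjoint orbit at the point `Φ x`. -/
theorem coisotropic_iff (hΦ : IsHamiltonianAction G σ Φ) {A : Submodule ℝ ((𝔤₀ →L[ℝ] ℝ) → ℝ)}
    (hA : ∀ h ∈ A, ContDiff ℝ ∞ h) {x : M}
    (hx : diffSpan E (invariantFunctions E G M) x =
      (LinearMap.range (infAction 𝔤₀ E G x).toLinearMap).dualAnnihilator) :
    Module.finrank ℝ (diffSpan E (pullback Φ A ⊔ invariantFunctions E G M) x) +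
      Module.finrank ℝ ((σ.at_ x).poissonKer
        (diffSpan E (pullback Φ A ⊔ invariantFunctions E G M) x)) = Module.finrank ℝ E ↔
      IsCoisotropicAt G A (Φ x) := by
  rw [diffSpan_sup (contMDiff_of_mem_pullback hΦ.smooth_moment hA) (contMDiff_of_mem_invariantFunctions), hx,
    hΦ.diffSpan_pullback hA]
  have h := (σ.at_ x).coisotropic_iff (infAction 𝔤₀ E G x).toLinearMap (gradSpan A (Φ x))
  refine Iff.trans h ?_
  have key (ξ η : 𝔤₀) : (σ.at_ x).form ((infAction 𝔤₀ E G x).toLinearMap ξ)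
      ((infAction 𝔤₀ E G x).toLinearMap η) = Φ x (lieBr G ξ η) := hΦ.form_infAction_infAction x ξ η
  simp only [key]
  exact Iff.rfl

end IsHamiltonianAction

end Hamiltonian

/-! ### The derivative of the adjoint action -/

section ChartDerivative

variable {E : Type*} [NormedAddCommGroup E] [NormedSpace ℝ E]
  {M : Type*} [TopologicalSpace M] [ChartedSpace E M]
  {F : Type*} [NormedAddCommGroup F] [NormedSpace ℝ F]

/-- The tangent space at `x` is identified with `E` through the preferred chart at `x`, so in that
chart the two derivatives are the same map. -/
theorem HasMFDerivAt.hasFDerivAt_comp_chartAt_symm {f : M → F} {x : M} {L : E →L[ℝ] F}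
    (h : HasMFDerivAt 𝓘(ℝ, E) 𝓘(ℝ, F) f x L) :
    HasFDerivAt (f ∘ (chartAt E x).symm) L (chartAt E x x) := by
  have h2 := h.2
  rw [← hasFDerivWithinAt_univ]
  simp only [writtenInExtChartAt, mfld_simps, chartAt_self_eq] at h2
  exact h2

theorem hasMFDerivAt_of_hasFDerivAt_comp_chartAt_symm {f : M → F} {x : M} {L : E →L[ℝ] F}
    (h : HasFDerivAt (f ∘ (chartAt E x).symm) L (chartAt E x x)) :
    HasMFDerivAt 𝓘(ℝ, E) 𝓘(ℝ, F) f x L := by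
  refine ⟨?_, ?_⟩
  · have h1 : ContinuousAt ((f ∘ (chartAt E x).symm) ∘ chartAt E x) x :=
      h.continuousAt.comp ((chartAt E x).continuousAt (mem_chart_source E x))
    refine h1.congr ?_
    filter_upwards [(chartAt E x).open_source.mem_nhds (mem_chart_source E x)] with y hy
    simp [(chartAt E x).left_inv hy]
  · rw [← hasFDerivWithinAt_univ] at h
    simp only [writtenInExtChartAt, mfld_simps, chartAt_self_eq]
    exact h

theorem mdifferentiableAt_chartAt [IsManifold 𝓘(ℝ, E) 1 M] {x y : M}
    (hy : y ∈ (chartAt E x).source) : MDifferentiableAt 𝓘(ℝ, E) 𝓘(ℝ, E) (chartAt E x) y :=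
  mdifferentiableAt_atlas (chart_mem_atlas E x) hy

theorem mdifferentiableAt_chartAt_symm [IsManifold 𝓘(ℝ, E) 1 M] {x : M} {y : E}
    (hy : y ∈ (chartAt E x).target) : MDifferentiableAt 𝓘(ℝ, E) 𝓘(ℝ, E) (chartAt E x).symm y :=
  mdifferentiableAt_atlas_symm (chart_mem_atlas E x) hy

/-- A function with everywhere vanishing derivative on a connected manifold is constant. -/
theorem eq_of_hasMFDerivAt_zero [IsManifold 𝓘(ℝ, E) 1 M] [ConnectedSpace M] {f : M → F}
    (h : ∀ x, HasMFDerivAt 𝓘(ℝ, E) 𝓘(ℝ, F) f x (0 : E →L[ℝ] F)) (x y : M) : f x = f y := by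
  refine IsLocallyConstant.apply_eq_of_preconnectedSpace
    ((IsLocallyConstant.iff_eventually_eq f).2 fun x₀ => ?_) x y
  set e := chartAt E x₀
  have hx₀ : e x₀ ∈ e.target := e.map_source (mem_chart_source E x₀)
  obtain ⟨r, hr, hball⟩ := Metric.isOpen_iff.1 e.open_target _ hx₀
  have hd : ∀ z ∈ Metric.ball (e x₀) r, HasFDerivAt (f ∘ e.symm) (0 : E →L[ℝ] F) z := by
    intro z hz
    have h1 := HasMFDerivAt.comp z (h (e.symm z))
      (mdifferentiableAt_chartAt_symm (hball hz)).hasMFDerivAt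
    have h2 := hasMFDerivAt_iff_hasFDerivAt.1 h1
    convert! h2 using 1
  have hmem : e ⁻¹' Metric.ball (e x₀) r ∈ 𝓝 x₀ :=
    (e.continuousAt (mem_chart_source E x₀)).preimage_mem_nhds (Metric.ball_mem_nhds _ hr)
  filter_upwards [hmem, e.open_source.mem_nhds (mem_chart_source E x₀)] with z hz hzs
  have h3 := (convex_ball (e x₀) r).is_const_of_fderivWithin_eq_zero (𝕜 := ℝ)
    (f := f ∘ e.symm) (fun w hw => (hd w hw).differentiableAt.differentiableWithinAt)
    (fun w hw => by
      rw [fderivWithin_of_isOpen Metric.isOpen_ball hw, (hd w hw).fderiv]) hz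
    (Metric.mem_ball_self hr)
  simpa [e.left_inv hzs, e.left_inv (mem_chart_source E x₀)] using h3

end ChartDerivative

/-! ### Multiplication in a chart, the Lie bracket and the adjoint action. -/

section Adjoint

variable {𝔤₀ : Type*} [NormedAddCommGroup 𝔤₀] [NormedSpace ℝ 𝔤₀]
  (G : Type*) [TopologicalSpace G] [ChartedSpace 𝔤₀ G] [Group G] [LieGroup 𝓘(ℝ, 𝔤₀) ∞ G]

/-- The multiplication of a Lie group in the preferred chart at `1`. -/
def chartMul (x : 𝔤₀ × 𝔤₀) : 𝔤₀ :=
  chartAt 𝔤₀ (1 : G) ((chartAt 𝔤₀ (1 : G)).symm x.1 * (chartAt 𝔤₀ (1 : G)).symm x.2)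

/-- The coordinates of the unit in the preferred chart. -/
def chartOne : 𝔤₀ := chartAt 𝔤₀ (1 : G) 1

omit [NormedSpace ℝ 𝔤₀] [LieGroup 𝓘(ℝ, 𝔤₀) ∞ G] in
theorem chartOne_mem_target : chartOne G ∈ (chartAt 𝔤₀ (1 : G)).target :=
  (chartAt 𝔤₀ (1 : G)).map_source (mem_chart_source 𝔤₀ 1)

omit [NormedSpace ℝ 𝔤₀] [LieGroup 𝓘(ℝ, 𝔤₀) ∞ G] in
theorem chartAt_symm_chartOne : (chartAt 𝔤₀ (1 : G)).symm (chartOne G) = 1 :=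
  (chartAt 𝔤₀ (1 : G)).left_inv (mem_chart_source 𝔤₀ 1)

theorem isManifold_one_lieGroup : IsManifold 𝓘(ℝ, 𝔤₀) 1 G :=
  IsManifold.of_le (n := ∞) (by simp)

theorem contDiffAt_chartMul : ContDiffAt ℝ ∞ (chartMul (𝔤₀ := 𝔤₀) G) (chartOne G, chartOne G) := by
  rw [← contMDiffAt_iff_contDiffAt]
  have hs : ContMDiffAt 𝓘(ℝ, 𝔤₀) 𝓘(ℝ, 𝔤₀) ∞ (chartAt 𝔤₀ (1 : G)).symm (chartOne G) :=
    (contMDiffOn_chart_symm (I := 𝓘(ℝ, 𝔤₀)) (x := (1 : G))).contMDiffAt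
      ((chartAt 𝔤₀ (1 : G)).open_target.mem_nhds (chartOne_mem_target G))
  have h1 : ContMDiffAt 𝓘(ℝ, 𝔤₀ × 𝔤₀) 𝓘(ℝ, 𝔤₀) ∞
      (fun x : 𝔤₀ × 𝔤₀ => (chartAt 𝔤₀ (1 : G)).symm x.1) (chartOne G, chartOne G) :=
    ContMDiffAt.comp (chartOne G, chartOne G) (g := (chartAt 𝔤₀ (1 : G)).symm) hs
      contDiff_fst.contMDiff.contMDiffAt
  have h2 : ContMDiffAt 𝓘(ℝ, 𝔤₀ × 𝔤₀) 𝓘(ℝ, 𝔤₀) ∞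
      (fun x : 𝔤₀ × 𝔤₀ => (chartAt 𝔤₀ (1 : G)).symm x.2) (chartOne G, chartOne G) :=
    ContMDiffAt.comp (chartOne G, chartOne G) (g := (chartAt 𝔤₀ (1 : G)).symm) hs
      contDiff_snd.contMDiff.contMDiffAt
  have h3 := h1.mul h2
  have hc : ContMDiffAt 𝓘(ℝ, 𝔤₀) 𝓘(ℝ, 𝔤₀) ∞ (chartAt 𝔤₀ (1 : G))
      ((chartAt 𝔤₀ (1 : G)).symm (chartOne G) * (chartAt 𝔤₀ (1 : G)).symm (chartOne G)) := by
    rw [chartAt_symm_chartOne, mul_one]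
    exact (contMDiffOn_chart (I := 𝓘(ℝ, 𝔤₀)) (x := (1 : G))).contMDiffAt
      ((chartAt 𝔤₀ (1 : G)).open_source.mem_nhds (mem_chart_source 𝔤₀ 1))
  exact ContMDiffAt.comp (chartOne G, chartOne G) hc h3

/-- The derivative at the unit of the left translation by `x`, in coordinates. -/
def leftDeriv (x : 𝔤₀) : 𝔤₀ →L[ℝ] 𝔤₀ :=
  (fderiv ℝ (chartMul G) (x, chartOne G)).comp (ContinuousLinearMap.inr ℝ 𝔤₀ 𝔤₀)

/-- The derivative at the unit of the right translation by `x`, in coordinates. -/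
def rightDeriv (x : 𝔤₀) : 𝔤₀ →L[ℝ] 𝔤₀ :=
  (fderiv ℝ (chartMul G) (chartOne G, x)).comp (ContinuousLinearMap.inl ℝ 𝔤₀ 𝔤₀)

theorem hasFDerivAt_fderiv_chartMul : HasFDerivAt (fderiv ℝ (chartMul (𝔤₀ := 𝔤₀) G))
    (fderiv ℝ (fderiv ℝ (chartMul G)) (chartOne G, chartOne G)) (chartOne G, chartOne G) :=
  (((contDiffAt_chartMul G).fderiv_right (m := 1)
    (WithTop.coe_le_coe.2 (le_top : ((1 : ℕ∞) + 1) ≤ ⊤))).differentiableAt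
    one_ne_zero).hasFDerivAt

theorem hasFDerivAt_leftDeriv_apply (η : 𝔤₀) : HasFDerivAt (fun x => leftDeriv G x η)
    ((fderiv ℝ (fderiv ℝ (chartMul G)) (chartOne G, chartOne G)).flip (0, η) ∘L
      ContinuousLinearMap.inl ℝ 𝔤₀ 𝔤₀) (chartOne G) := by
  have h1 : HasFDerivAt (fun x : 𝔤₀ => (x, chartOne (𝔤₀ := 𝔤₀) G))
      (ContinuousLinearMap.inl ℝ 𝔤₀ 𝔤₀) (chartOne G) := hasFDerivAt_prodMk_left _ _
  have h2 := (hasFDerivAt_fderiv_chartMul (𝔤₀ := 𝔤₀) G).comp (f := fun x => (x, chartOne G)) (chartOne G) h1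
  have h3 := h2.clm_apply (hasFDerivAt_const (((0 : 𝔤₀), η)) (chartOne (𝔤₀ := 𝔤₀) G))
  refine h3.congr_fderiv ?_
  ext ξ
  simp

theorem differentiableAt_leftDeriv : DifferentiableAt ℝ (leftDeriv (𝔤₀ := 𝔤₀) G) (chartOne G) := by
  have h1 : HasFDerivAt (fun x : 𝔤₀ => (x, chartOne (𝔤₀ := 𝔤₀) G))
      (ContinuousLinearMap.inl ℝ 𝔤₀ 𝔤₀) (chartOne G) := hasFDerivAt_prodMk_left _ _
  have h2 := (hasFDerivAt_fderiv_chartMul (𝔤₀ := 𝔤₀) G).comp (f := fun x => (x, chartOne G)) (chartOne G) h1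
  exact h2.differentiableAt.clm_comp (differentiableAt_const _)

theorem hasFDerivAt_rightDeriv_apply (η : 𝔤₀) : HasFDerivAt (fun x => rightDeriv G x η)
    ((fderiv ℝ (fderiv ℝ (chartMul G)) (chartOne G, chartOne G)).flip (η, 0) ∘L
      ContinuousLinearMap.inr ℝ 𝔤₀ 𝔤₀) (chartOne G) := by
  have h1 : HasFDerivAt (fun x : 𝔤₀ => (chartOne (𝔤₀ := 𝔤₀) G, x))
      (ContinuousLinearMap.inr ℝ 𝔤₀ 𝔤₀) (chartOne G) := hasFDerivAt_prodMk_right _ _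
  have h2 := (hasFDerivAt_fderiv_chartMul (𝔤₀ := 𝔤₀) G).comp (f := fun x => (chartOne G, x)) (chartOne G) h1
  have h3 := h2.clm_apply (hasFDerivAt_const ((η, (0 : 𝔤₀))) (chartOne (𝔤₀ := 𝔤₀) G))
  refine h3.congr_fderiv ?_
  ext ξ
  simp

theorem differentiableAt_rightDeriv :
    DifferentiableAt ℝ (rightDeriv (𝔤₀ := 𝔤₀) G) (chartOne G) := by
  have h1 : HasFDerivAt (fun x : 𝔤₀ => (chartOne (𝔤₀ := 𝔤₀) G, x))
      (ContinuousLinearMap.inr ℝ 𝔤₀ 𝔤₀) (chartOne G) := hasFDerivAt_prodMk_right _ _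
  have h2 := (hasFDerivAt_fderiv_chartMul (𝔤₀ := 𝔤₀) G).comp (f := fun x => (chartOne G, x)) (chartOne G) h1
  exact h2.differentiableAt.clm_comp (differentiableAt_const _)

theorem eventually_differentiableAt_chartMul :
    ∀ᶠ z in 𝓝 (chartOne G, chartOne G), DifferentiableAt ℝ (chartMul (𝔤₀ := 𝔤₀) G) z := by
  filter_upwards [((contDiffAt_chartMul (𝔤₀ := 𝔤₀) G).of_le
    (m := 1) (by simp)).eventually (by simp)] with z hz
  exact hz.differentiableAt one_ne_zero

theorem eventually_hasFDerivAt_leftDeriv : ∀ᶠ x in 𝓝 (chartOne G),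
    HasFDerivAt (fun y : 𝔤₀ => chartMul G (x, y)) (leftDeriv G x) (chartOne G) := by
  have hc : ContinuousAt (fun x : 𝔤₀ => (x, chartOne (𝔤₀ := 𝔤₀) G)) (chartOne G) := by fun_prop
  filter_upwards [hc.eventually (eventually_differentiableAt_chartMul (𝔤₀ := 𝔤₀) G)] with x hx
  exact hx.hasFDerivAt.comp (f := fun y => (x, y)) (chartOne G) (hasFDerivAt_prodMk_right _ _)

theorem eventually_hasFDerivAt_rightDeriv : ∀ᶠ x in 𝓝 (chartOne G),
    HasFDerivAt (fun y : 𝔤₀ => chartMul G (y, x)) (rightDeriv G x) (chartOne G) := by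
  have hc : ContinuousAt (fun x : 𝔤₀ => (chartOne (𝔤₀ := 𝔤₀) G, x)) (chartOne G) := by fun_prop
  filter_upwards [hc.eventually (eventually_differentiableAt_chartMul (𝔤₀ := 𝔤₀) G)] with x hx
  exact hx.hasFDerivAt.comp (f := fun y => (y, x)) (chartOne G) (hasFDerivAt_prodMk_left _ _)

theorem leftDeriv_chartOne : leftDeriv G (chartOne G) = ContinuousLinearMap.id ℝ 𝔤₀ := by
  have h1 := (eventually_hasFDerivAt_leftDeriv (𝔤₀ := 𝔤₀) G).self_of_nhds
  refine h1.unique ((hasFDerivAt_id _).congr_of_eventuallyEq ?_)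
  filter_upwards [(chartAt 𝔤₀ (1 : G)).open_target.mem_nhds (chartOne_mem_target G)] with y hy
  simp only [chartMul, chartAt_symm_chartOne, one_mul, id]
  exact (chartAt 𝔤₀ (1 : G)).right_inv hy

theorem rightDeriv_chartOne : rightDeriv G (chartOne G) = ContinuousLinearMap.id ℝ 𝔤₀ := by
  have h1 := (eventually_hasFDerivAt_rightDeriv (𝔤₀ := 𝔤₀) G).self_of_nhds
  refine h1.unique ((hasFDerivAt_id _).congr_of_eventuallyEq ?_)
  filter_upwards [(chartAt 𝔤₀ (1 : G)).open_target.mem_nhds (chartOne_mem_target G)] with y hy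
  simp only [chartMul, chartAt_symm_chartOne, mul_one, id]
  exact (chartAt 𝔤₀ (1 : G)).right_inv hy

theorem hasMFDerivAt_chartAt_self {E : Type*} [NormedAddCommGroup E] [NormedSpace ℝ E]
    {M : Type*} [TopologicalSpace M] [ChartedSpace E M] (x : M) :
    HasMFDerivAt 𝓘(ℝ, E) 𝓘(ℝ, E) (chartAt E x) x (ContinuousLinearMap.id ℝ E) := by
  apply hasMFDerivAt_of_hasFDerivAt_comp_chartAt_symm
  refine (hasFDerivAt_id _).congr_of_eventuallyEq ?_
  filter_upwards [(chartAt E x).open_target.mem_nhds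
    ((chartAt E x).map_source (mem_chart_source E x))] with y hy
  exact (chartAt E x).right_inv hy

/-- The Lie bracket of vector fields in the preferred chart. -/
theorem mlieBracket_eq_lieBracket_chartAt {E : Type*} [NormedAddCommGroup E] [NormedSpace ℝ E]
    {M : Type*} [TopologicalSpace M] [ChartedSpace E M] (x : M)
    (V W : ∀ y : M, TangentSpace 𝓘(ℝ, E) y) :
    (VectorField.mlieBracket 𝓘(ℝ, E) V W x : E) = VectorField.lieBracket ℝ
      (fun z : E => (VectorField.mpullback 𝓘(ℝ, E) 𝓘(ℝ, E) (chartAt E x).symm V z : E))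
      (fun z : E => (VectorField.mpullback 𝓘(ℝ, E) 𝓘(ℝ, E) (chartAt E x).symm W z : E))
      (chartAt E x x) := by
  have h1 : extChartAt 𝓘(ℝ, E) x = (chartAt E x).toPartialEquiv := by
    simp only [mfld_simps]
  have h2 := VectorField.mlieBracketWithin_apply (I := 𝓘(ℝ, E)) (V := V) (W := W)
    (s := Set.univ) (x₀ := x)
  rw [VectorField.mlieBracketWithin_univ, h1] at h2
  refine h2.trans ?_
  have key : ∀ L : E →L[ℝ] E, L = ContinuousLinearMap.id ℝ E → ∀ u v : E, u = v →
      L.inverse u = v := by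
    rintro _ rfl u _ rfl
    simp
  refine key _ (hasMFDerivAt_chartAt_self x).mfderiv _ _ ?_
  have h3 : Set.range 𝓘(ℝ, E) = Set.univ := by simp
  rw [h3, VectorField.mpullbackWithin_univ, VectorField.mpullbackWithin_univ, Set.preimage_univ,
    Set.univ_inter]
  exact congrFun (VectorField.lieBracketWithin_univ (𝕜 := ℝ)) _

/-- The left-invariant vector fields in the preferred chart at `1`. -/
theorem eventually_mpullback_mulInvariantVectorField (ξ : 𝔤₀) :
    ∀ᶠ x in 𝓝 (chartOne G), (VectorField.mpullback 𝓘(ℝ, 𝔤₀) 𝓘(ℝ, 𝔤₀)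
      (chartAt 𝔤₀ (1 : G)).symm (mulInvariantVectorField (I := 𝓘(ℝ, 𝔤₀)) (G := G) ξ) x : 𝔤₀) =
        leftDeriv G x ξ := by
  have := isManifold_one_lieGroup (𝔤₀ := 𝔤₀) G
  filter_upwards [eventually_hasFDerivAt_leftDeriv (𝔤₀ := 𝔤₀) G,
    (chartAt 𝔤₀ (1 : G)).open_target.mem_nhds (chartOne_mem_target G)] with x hx hxt
  set φ := chartAt 𝔤₀ (1 : G) with hφ
  have hs : φ.symm x ∈ φ.source := φ.map_target hxt
  -- the derivative of the left translation in the chart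
  have hL : HasMFDerivAt 𝓘(ℝ, 𝔤₀) 𝓘(ℝ, 𝔤₀) (fun h : G => φ.symm x * h) 1
      (mfderiv 𝓘(ℝ, 𝔤₀) 𝓘(ℝ, 𝔤₀) (fun h : G => φ.symm x * h) 1) :=
    ((contMDiff_mul_left (I := 𝓘(ℝ, 𝔤₀)) (n := ∞) (a := φ.symm x)).mdifferentiable
      (by simp) 1).hasMFDerivAt
  have hP : HasMFDerivAt 𝓘(ℝ, 𝔤₀) 𝓘(ℝ, 𝔤₀) φ (φ.symm x * 1)
      (mfderiv 𝓘(ℝ, 𝔤₀) 𝓘(ℝ, 𝔤₀) φ (φ.symm x * 1)) :=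
    (mdifferentiableAt_chartAt (by rw [mul_one]; exact hs)).hasMFDerivAt
  have h1 := (HasMFDerivAt.comp 1 hP hL).hasFDerivAt_comp_chartAt_symm
  have h2 := h1.unique hx
  have h3 : VectorField.mpullback 𝓘(ℝ, 𝔤₀) 𝓘(ℝ, 𝔤₀)
      φ.symm (mulInvariantVectorField (I := 𝓘(ℝ, 𝔤₀)) (G := G) ξ) x =
      mfderiv 𝓘(ℝ, 𝔤₀) 𝓘(ℝ, 𝔤₀) φ (φ.symm x)
        (mulInvariantVectorField (I := 𝓘(ℝ, 𝔤₀)) (G := G) ξ (φ.symm x)) := by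
    rw [VectorField.mpullback_apply]
    congr 1
    apply ContinuousLinearMap.inverse_eq
    -- The base point is generalized because `φ (φ.symm x) = x` is not definitional, while the
    -- tangent spaces depend on it.
    · have h4 : ∀ z, z = x → (mfderiv 𝓘(ℝ, 𝔤₀) 𝓘(ℝ, 𝔤₀) φ.symm z).comp
          (mfderiv 𝓘(ℝ, 𝔤₀) 𝓘(ℝ, 𝔤₀) φ (φ.symm x)) = ContinuousLinearMap.id ℝ 𝔤₀ →
          (mfderiv 𝓘(ℝ, 𝔤₀) 𝓘(ℝ, 𝔤₀) φ.symm x).comp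
          (mfderiv 𝓘(ℝ, 𝔤₀) 𝓘(ℝ, 𝔤₀) φ (φ.symm x)) = ContinuousLinearMap.id ℝ 𝔤₀ := by
        rintro z rfl h
        exact h
      exact h4 _ (φ.right_inv hxt) ((mdifferentiable_chart (I := 𝓘(ℝ, 𝔤₀)) (1 : G)).symm_comp_deriv hs)
    · exact (mdifferentiable_chart (I := 𝓘(ℝ, 𝔤₀)) (1 : G)).comp_symm_deriv hxt
  rw [h3, ← h2]
  have h4 : ∀ z : G, z = φ.symm x → ∀ v : 𝔤₀, (mfderiv 𝓘(ℝ, 𝔤₀) 𝓘(ℝ, 𝔤₀) φ (φ.symm x) v : 𝔤₀) =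
      mfderiv 𝓘(ℝ, 𝔤₀) 𝓘(ℝ, 𝔤₀) φ z v := by
    rintro z rfl v
    rfl
  exact h4 _ (mul_one _) _

/-- In the chart the left-invariant fields are `x ↦ leftDeriv G x ξ`, equal to `ξ` at the unit, and
their derivatives there are mixed second derivatives of the multiplication. -/
theorem lieBr_eq [FiniteDimensional ℝ 𝔤₀] (ξ η : 𝔤₀) : lieBr G ξ η =
    fderiv ℝ (fderiv ℝ (chartMul G)) (chartOne G, chartOne G) (ξ, 0) (0, η) -
      fderiv ℝ (fderiv ℝ (chartMul G)) (chartOne G, chartOne G) (η, 0) (0, ξ) := by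
  have h1 : lieBr G ξ η = (VectorField.mlieBracket 𝓘(ℝ, 𝔤₀)
      (mulInvariantVectorField (I := 𝓘(ℝ, 𝔤₀)) (G := G) ξ)
      (mulInvariantVectorField (I := 𝓘(ℝ, 𝔤₀)) (G := G) η) 1 : 𝔤₀) := rfl
  rw [h1, mlieBracket_eq_lieBracket_chartAt]
  have h2 := Filter.EventuallyEq.lieBracket_vectorField_eq (𝕜 := ℝ)
    (eventually_mpullback_mulInvariantVectorField G ξ)
    (eventually_mpullback_mulInvariantVectorField G η)
  refine h2.trans ?_
  rw [VectorField.lieBracket, (hasFDerivAt_leftDeriv_apply G ξ).fderiv,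
    (hasFDerivAt_leftDeriv_apply G η).fderiv, leftDeriv_chartOne]
  simp

theorem mdifferentiable_conj (g : G) :
    MDifferentiable 𝓘(ℝ, 𝔤₀) 𝓘(ℝ, 𝔤₀) fun h : G => g * h * g⁻¹ := by
  have h1 : ContMDiff 𝓘(ℝ, 𝔤₀) 𝓘(ℝ, 𝔤₀) ∞ fun h : G => g * h * g⁻¹ :=
    (contMDiff_mul_left (I := 𝓘(ℝ, 𝔤₀)) (n := ∞) (a := g)).mul contMDiff_const
  exact h1.mdifferentiable (by simp)

/-- The adjoint action is the derivative of the conjugation. -/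
theorem hasMFDerivAt_conj (g : G) :
    HasMFDerivAt 𝓘(ℝ, 𝔤₀) 𝓘(ℝ, 𝔤₀) (fun h : G => g * h * g⁻¹) 1 (bigAd (𝔤₀ := 𝔤₀) G g) :=
  (mdifferentiable_conj G g 1).hasMFDerivAt

/-- The adjoint action in coordinates. -/
theorem hasFDerivAt_chart_conj (g : G) :
    HasFDerivAt (fun y : 𝔤₀ => chartAt 𝔤₀ (1 : G) (g * (chartAt 𝔤₀ (1 : G)).symm y * g⁻¹))
      (bigAd G g) (chartOne G) := by
  have h1 : HasMFDerivAt 𝓘(ℝ, 𝔤₀) 𝓘(ℝ, 𝔤₀) (chartAt 𝔤₀ (1 : G)) (g * 1 * g⁻¹)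
      (ContinuousLinearMap.id ℝ 𝔤₀) := by
    have h2 : ∀ z : G, z = 1 → HasMFDerivAt 𝓘(ℝ, 𝔤₀) 𝓘(ℝ, 𝔤₀) (chartAt 𝔤₀ (1 : G)) z
        (ContinuousLinearMap.id ℝ 𝔤₀) := by
      rintro z rfl
      exact hasMFDerivAt_chartAt_self 1
    exact h2 _ (by group)
  exact (HasMFDerivAt.comp 1 h1 (hasMFDerivAt_conj G g)).hasFDerivAt_comp_chartAt_symm

theorem bigAd_one : bigAd G (1 : G) = ContinuousLinearMap.id ℝ 𝔤₀ := by
  refine (hasFDerivAt_chart_conj (𝔤₀ := 𝔤₀) G 1).unique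
    ((hasFDerivAt_id _).congr_of_eventuallyEq ?_)
  filter_upwards [(chartAt 𝔤₀ (1 : G)).open_target.mem_nhds (chartOne_mem_target G)] with y hy
  simp [(chartAt 𝔤₀ (1 : G)).right_inv hy]

theorem eventually_mem_source_conj (g : G) : ∀ᶠ y in 𝓝 (chartOne G),
    g * (chartAt 𝔤₀ (1 : G)).symm y * g⁻¹ ∈ (chartAt 𝔤₀ (1 : G)).source := by
  have := topologicalGroup_of_lieGroup 𝓘(ℝ, 𝔤₀) (G := G) ∞
  have hc : ContinuousAt (fun y => g * (chartAt 𝔤₀ (1 : G)).symm y * g⁻¹) (chartOne G) :=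
    (continuousAt_const.mul ((chartAt 𝔤₀ (1 : G)).continuousAt_symm
      (chartOne_mem_target G))).mul continuousAt_const
  refine hc.preimage_mem_nhds ((chartAt 𝔤₀ (1 : G)).open_source.mem_nhds ?_)
  rw [chartAt_symm_chartOne, mul_one, mul_inv_cancel]
  exact mem_chart_source 𝔤₀ 1

theorem bigAd_mul (g h : G) : bigAd (𝔤₀ := 𝔤₀) G (g * h) = (bigAd G g).comp (bigAd G h) := by
  have h1 := hasFDerivAt_chart_conj (𝔤₀ := 𝔤₀) G g
  have h2 := hasFDerivAt_chart_conj (𝔤₀ := 𝔤₀) G h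
  have h3 : chartAt 𝔤₀ (1 : G) (h * (chartAt 𝔤₀ (1 : G)).symm (chartOne G) * h⁻¹) =
      chartOne G := by
    rw [chartAt_symm_chartOne, mul_one, mul_inv_cancel, chartOne]
  rw [← h3] at h1
  have h4 := HasFDerivAt.comp (chartOne G) (g := fun y : 𝔤₀ => chartAt 𝔤₀ (1 : G)
    (g * (chartAt 𝔤₀ (1 : G)).symm y * g⁻¹)) h1 h2
  refine (hasFDerivAt_chart_conj (𝔤₀ := 𝔤₀) G (g * h)).unique (h4.congr_of_eventuallyEq ?_)
  filter_upwards [eventually_mem_source_conj (𝔤₀ := 𝔤₀) G h] with y hy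
  simp only [Function.comp_apply, (chartAt 𝔤₀ (1 : G)).left_inv hy]
  congr 1
  group

/-- Differentiate `g h = (g h g⁻¹) g` in `h` at the unit. -/
theorem eventually_rightDeriv_comp_bigAd : ∀ᶠ x in 𝓝 (chartOne G),
    (rightDeriv G x).comp (bigAd (𝔤₀ := 𝔤₀) G ((chartAt 𝔤₀ (1 : G)).symm x)) = leftDeriv G x := by
  filter_upwards [eventually_hasFDerivAt_leftDeriv (𝔤₀ := 𝔤₀) G,
    eventually_hasFDerivAt_rightDeriv (𝔤₀ := 𝔤₀) G] with x hl hr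
  set g := (chartAt 𝔤₀ (1 : G)).symm x with hg
  have h3 : chartAt 𝔤₀ (1 : G) (g * (chartAt 𝔤₀ (1 : G)).symm (chartOne G) * g⁻¹) =
      chartOne G := by
    rw [chartAt_symm_chartOne, mul_one, mul_inv_cancel, chartOne]
  rw [← h3] at hr
  have h4 := HasFDerivAt.comp (chartOne G) (g := fun y : 𝔤₀ => chartMul G (y, x)) hr
    (hasFDerivAt_chart_conj (𝔤₀ := 𝔤₀) G g)
  refine (h4.congr_of_eventuallyEq ?_).unique hl |>.trans ?_
  · filter_upwards [eventually_mem_source_conj (𝔤₀ := 𝔤₀) G g] with y hy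
    simp only [Function.comp_apply, chartMul, (chartAt 𝔤₀ (1 : G)).left_inv hy, ← hg]
    rw [inv_mul_cancel_right]
  · rfl

/-- Near the unit `Ad = R⁻¹ L`, where `R` and `L` are the derivatives of the right and left
translations; `R` is the identity at the unit, hence invertible nearby. -/
theorem differentiableAt_bigAd_chart [FiniteDimensional ℝ 𝔤₀] : DifferentiableAt ℝ
    (fun x : 𝔤₀ => bigAd (𝔤₀ := 𝔤₀) G ((chartAt 𝔤₀ (1 : G)).symm x)) (chartOne G) := by
  have hR := differentiableAt_rightDeriv (𝔤₀ := 𝔤₀) G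
  have h1 : DifferentiableAt ℝ (fun x : 𝔤₀ => Ring.inverse (rightDeriv G x)) (chartOne G) := by
    have h2 : DifferentiableAt ℝ (Ring.inverse (M₀ := 𝔤₀ →L[ℝ] 𝔤₀))
        (rightDeriv G (chartOne (𝔤₀ := 𝔤₀) G)) := by
      rw [rightDeriv_chartOne]
      exact differentiableAt_inverse (R := 𝔤₀ →L[ℝ] 𝔤₀) (𝕜 := ℝ) isUnit_one
    exact DifferentiableAt.comp (chartOne G) h2 hR
  have hunit : ∀ᶠ x in 𝓝 (chartOne (𝔤₀ := 𝔤₀) G), IsUnit (rightDeriv (𝔤₀ := 𝔤₀) G x) := by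
    refine hR.continuousAt.tendsto.eventually (p := fun L : 𝔤₀ →L[ℝ] 𝔤₀ => IsUnit L) ?_
    refine Units.isOpen.mem_nhds ?_
    rw [rightDeriv_chartOne]
    exact isUnit_one
  refine (h1.clm_comp (differentiableAt_leftDeriv (𝔤₀ := 𝔤₀) G)).congr_of_eventuallyEq ?_
  filter_upwards [hunit, eventually_rightDeriv_comp_bigAd (𝔤₀ := 𝔤₀) G] with x hx hx2
  rw [← hx2]
  change _ = Ring.inverse (rightDeriv (𝔤₀ := 𝔤₀) G x) * (rightDeriv G x * _)
  rw [← mul_assoc, Ring.inverse_mul_cancel _ hx, one_mul]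

/-- The derivative of the adjoint action at the unit is the Lie bracket. -/
theorem hasFDerivAt_bigAd_chart_apply [FiniteDimensional ℝ 𝔤₀] (η : 𝔤₀) : HasFDerivAt
    (fun x : 𝔤₀ => bigAd (𝔤₀ := 𝔤₀) G ((chartAt 𝔤₀ (1 : G)).symm x) η)
    (LinearMap.toContinuousLinearMap ((lieBr G).flip η)) (chartOne G) := by
  have hD := (differentiableAt_bigAd_chart (𝔤₀ := 𝔤₀) G).clm_apply
    (differentiableAt_const (c := η)) |>.hasFDerivAt
  set D := fderiv ℝ (fun x : 𝔤₀ => bigAd (𝔤₀ := 𝔤₀) G ((chartAt 𝔤₀ (1 : G)).symm x) η) (chartOne G)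
  -- Differentiating `R_x (Ad_x η) = L_x η` at the unit expresses `D` as the derivative of `L` minus
  -- that of `R`; the symmetry of the second derivative makes this the formula for the bracket.
  have h1 := ((differentiableAt_rightDeriv (𝔤₀ := 𝔤₀) G).hasFDerivAt).clm_apply hD
  have h2 : HasFDerivAt (fun x => leftDeriv G x η) _ (chartOne G) :=
    h1.congr_of_eventuallyEq (by
      filter_upwards [eventually_rightDeriv_comp_bigAd (𝔤₀ := 𝔤₀) G] with x hx
      rw [← hx]
      rfl)
  have h3 := h2.unique (hasFDerivAt_leftDeriv_apply G η)
  have h4 := ((differentiableAt_rightDeriv (𝔤₀ := 𝔤₀) G).hasFDerivAt.clm_apply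
    (hasFDerivAt_const η (chartOne (𝔤₀ := 𝔤₀) G))).unique (hasFDerivAt_rightDeriv_apply G η)
  have hsymm := (contDiffAt_chartMul (𝔤₀ := 𝔤₀) G).isSymmSndFDerivAt (by
    rw [minSmoothness_of_isRCLikeNormedField]
    exact WithTop.coe_le_coe.2 (le_top : (2 : ℕ∞) ≤ ⊤))
  refine hD.congr_fderiv ?_
  ext ξ
  have h5 := DFunLike.congr_fun h3 ξ
  have h6 := DFunLike.congr_fun h4 ξ
  simp [chartAt_symm_chartOne, bigAd_one, rightDeriv_chartOne] at h5 h6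
  have h7 := hsymm (η, 0) (0, ξ)
  change D ξ = lieBr G ξ η
  rw [lieBr_eq, h7, ← h5, ← h6]
  abel

end Adjoint

/-! ### Equivariance of the moment map -/

section Equivariance

variable {𝔤₀ : Type*} [NormedAddCommGroup 𝔤₀] [NormedSpace ℝ 𝔤₀] [FiniteDimensional ℝ 𝔤₀]
  {G : Type*} [TopologicalSpace G] [ChartedSpace 𝔤₀ G] [Group G] [LieGroup 𝓘(ℝ, 𝔤₀) ∞ G]
  {E : Type*} [NormedAddCommGroup E] [NormedSpace ℝ E] [FiniteDimensional ℝ E]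
  {M : Type*} [TopologicalSpace M] [ChartedSpace E M] [MulAction G M]
  [ContMDiffSMul 𝓘(ℝ, 𝔤₀) 𝓘(ℝ, E) ∞ G M]
  {σ : SymplecticForm E M} {Φ : M → (𝔤₀ →L[ℝ] ℝ)}

omit [FiniteDimensional ℝ 𝔤₀] [LieGroup 𝓘(ℝ, 𝔤₀) ∞ G] [FiniteDimensional ℝ E] in
variable (𝔤₀ G E) in
theorem hasMFDerivAt_smul_infAction (x : M) :
    HasMFDerivAt 𝓘(ℝ, 𝔤₀) 𝓘(ℝ, E) (fun g : G => g • x) 1 (infAction 𝔤₀ E G x) := by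
  have h : ContMDiff 𝓘(ℝ, 𝔤₀) 𝓘(ℝ, E) ∞ fun g : G => g • x :=
    (contMDiff_smul (I := 𝓘(ℝ, 𝔤₀)) (I' := 𝓘(ℝ, E)) (n := ∞) (G := G) (M := M)).comp
      (contMDiff_id.prodMk contMDiff_const)
  exact (h.mdifferentiable (by simp) 1).hasMFDerivAt

namespace IsHamiltonianAction

theorem hasFDerivAt_moment_smul (hΦ : IsHamiltonianAction G σ Φ) (x : M) :
    HasFDerivAt (fun y : 𝔤₀ => Φ ((chartAt 𝔤₀ (1 : G)).symm y • x))
      ((dMoment E Φ x).comp (infAction 𝔤₀ E G x) : 𝔤₀ →L[ℝ] (𝔤₀ →L[ℝ] ℝ)) (chartOne G) := by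
  have h1 : HasMFDerivAt 𝓘(ℝ, E) 𝓘(ℝ, 𝔤₀ →L[ℝ] ℝ) Φ ((1 : G) • x) (dMoment E Φ x) := by
    have h2 : ∀ z : M, z = x → HasMFDerivAt 𝓘(ℝ, E) 𝓘(ℝ, 𝔤₀ →L[ℝ] ℝ) Φ z (dMoment E Φ x) := by
      rintro z rfl
      exact (hΦ.smooth_moment.mdifferentiable (by simp) z).hasMFDerivAt
    exact h2 _ (one_smul G x)
  have h3 := HasMFDerivAt.comp (f := fun g : G => g • x) (1 : G) h1
    (hasMFDerivAt_smul_infAction 𝔤₀ G E x)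
  exact h3.hasFDerivAt_comp_chartAt_symm

/-- The function `g ↦ Φ(g • x) ∘ Ad_g`. -/
def twistedMoment (Φ : M → (𝔤₀ →L[ℝ] ℝ)) (x : M) (g : G) : 𝔤₀ →L[ℝ] ℝ :=
  (Φ (g • x)).comp (bigAd G g)

theorem hasMFDerivAt_twistedMoment_one (hΦ : IsHamiltonianAction G σ Φ) (x : M) :
    HasMFDerivAt 𝓘(ℝ, 𝔤₀) 𝓘(ℝ, 𝔤₀ →L[ℝ] ℝ) (twistedMoment (G := G) Φ x) 1
      (0 : 𝔤₀ →L[ℝ] (𝔤₀ →L[ℝ] ℝ)) := by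
  apply hasMFDerivAt_of_hasFDerivAt_comp_chartAt_symm
  have h1 := hΦ.hasFDerivAt_moment_smul x
  have h0 : DifferentiableAt ℝ (twistedMoment (G := G) Φ x ∘ (chartAt 𝔤₀ (1 : G)).symm)
      (chartOne G) :=
    h1.differentiableAt.clm_comp (differentiableAt_bigAd_chart (𝔤₀ := 𝔤₀) G)
  refine h0.hasFDerivAt.congr_fderiv ?_
  ext ξ η
  have h2 := h1.clm_apply (hasFDerivAt_bigAd_chart_apply G η)
  have h3 : HasFDerivAt (fun y : 𝔤₀ => (twistedMoment (G := G) Φ x ∘ (chartAt 𝔤₀ (1 : G)).symm) y η)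
      _ (chartOne (𝔤₀ := 𝔤₀) G) := h0.hasFDerivAt.clm_apply (hasFDerivAt_const η _)
  have h4 := DFunLike.congr_fun (h3.unique h2) ξ
  -- The product rule gives this term from the motion of `x` and `Φ x [ξ, η]` from the derivative of
  -- `Ad`; they cancel.
  have h5 : dMoment E Φ x (infAction 𝔤₀ E G x ξ) η = Φ x (lieBr G η ξ) := by
    rw [hΦ.dMoment_apply, hΦ.form_infAction_infAction]
  simp [chartAt_symm_chartOne, bigAd_one] at h4
  change fderiv ℝ (twistedMoment (G := G) Φ x ∘ (chartAt 𝔤₀ (1 : G)).symm) (chartOne G) ξ η = 0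
  rw [h4]
  change Φ x (lieBr G ξ η) + dMoment E Φ x (infAction 𝔤₀ E G x ξ) η = 0
  rw [h5, lieBr_skew, map_neg, neg_add_cancel]

omit [FiniteDimensional ℝ 𝔤₀] [TopologicalSpace M] in
-- Reduces the derivative at `g` to the derivative at the unit for the point `g • x`.
theorem twistedMoment_mul (x : M) (h g : G) :
    twistedMoment Φ x (h * g) = (twistedMoment Φ (g • x) h).comp (bigAd G g) := by
  rw [twistedMoment, twistedMoment, bigAd_mul, mul_smul, ContinuousLinearMap.comp_assoc]

theorem hasMFDerivAt_twistedMoment (hΦ : IsHamiltonianAction G σ Φ) (x : M) (g : G) :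
    HasMFDerivAt 𝓘(ℝ, 𝔤₀) 𝓘(ℝ, 𝔤₀ →L[ℝ] ℝ) (twistedMoment (G := G) Φ x) g
      (0 : 𝔤₀ →L[ℝ] (𝔤₀ →L[ℝ] ℝ)) := by
  let L : (𝔤₀ →L[ℝ] ℝ) →L[ℝ] (𝔤₀ →L[ℝ] ℝ) :=
    (ContinuousLinearMap.compL ℝ 𝔤₀ 𝔤₀ ℝ).flip (bigAd G g)
  have h1 : twistedMoment (G := G) Φ x = L ∘ (twistedMoment Φ (g • x)) ∘ fun k => k * g⁻¹ := by
    funext k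
    simp only [Function.comp_apply]
    rw [show twistedMoment Φ x k = twistedMoment Φ x (k * g⁻¹ * g) by rw [inv_mul_cancel_right],
      twistedMoment_mul]
    rfl
  have h2 : MDifferentiableAt 𝓘(ℝ, 𝔤₀) 𝓘(ℝ, 𝔤₀) (fun k : G => k * g⁻¹) g :=
    (contMDiff_mul_right (I := 𝓘(ℝ, 𝔤₀)) (n := ∞) (a := g⁻¹)).mdifferentiable (by simp) g
  have h3 : HasMFDerivAt 𝓘(ℝ, 𝔤₀) 𝓘(ℝ, 𝔤₀ →L[ℝ] ℝ) (twistedMoment (G := G) Φ (g • x)) (g * g⁻¹)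
      (0 : 𝔤₀ →L[ℝ] (𝔤₀ →L[ℝ] ℝ)) := by
    have : ∀ z : G, z = 1 → HasMFDerivAt 𝓘(ℝ, 𝔤₀) 𝓘(ℝ, 𝔤₀ →L[ℝ] ℝ)
        (twistedMoment (G := G) Φ (g • x)) z (0 : 𝔤₀ →L[ℝ] (𝔤₀ →L[ℝ] ℝ)) := by
      rintro z rfl
      exact hΦ.hasMFDerivAt_twistedMoment_one _
    exact this _ (mul_inv_cancel g)
  have h4 := HasMFDerivAt.comp g L.hasMFDerivAt (HasMFDerivAt.comp g h3 h2.hasMFDerivAt)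
  rw [h1]
  convert! h4 using 1

/-- The moment map of a Hamiltonian action of a connected Lie group is equivariant. -/
theorem moment_smul [ConnectedSpace G] (hΦ : IsHamiltonianAction G σ Φ) (g : G) (x : M) :
    Φ (g • x) = coAd G g (Φ x) := by
  have := isManifold_one_lieGroup (𝔤₀ := 𝔤₀) G
  have h1 := eq_of_hasMFDerivAt_zero (hΦ.hasMFDerivAt_twistedMoment x) g 1
  rw [twistedMoment, twistedMoment, bigAd_one, ContinuousLinearMap.comp_id, one_smul] at h1
  rw [coAd, ← h1, ContinuousLinearMap.comp_assoc, ← bigAd_mul, mul_inv_cancel, bigAd_one,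
    ContinuousLinearMap.comp_id]

end IsHamiltonianAction

end Equivariance

/-! ### The Poisson algebra generated by the pull-back and the invariants -/

/-- A form-preserving map is injective by nondegeneracy, hence bijective in equal dimensions, and so
it intertwines the maps `♯`. Used for the invariance of brackets under `G`. -/
theorem LinearSymplecticForm.poisson_eq_of_map {V W : Type*} [AddCommGroup V] [Module ℝ V]
    [FiniteDimensional ℝ V] [AddCommGroup W] [Module ℝ W] [FiniteDimensional ℝ W]
    {σ : LinearSymplecticForm V} {τ : LinearSymplecticForm W} (T : V →ₗ[ℝ] W)
    (hT : ∀ u v, τ.form (T u) (T v) = σ.form u v)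
    (hdim : Module.finrank ℝ V = Module.finrank ℝ W) {α α' : Module.Dual ℝ V}
    {β β' : Module.Dual ℝ W} (h : ∀ v, β (T v) = α v) (h' : ∀ v, β' (T v) = α' v) :
    τ.poisson β β' = σ.poisson α α' := by
  have hinj : Function.Injective T := by
    rw [injective_iff_map_eq_zero]
    intro u hu
    refine σ.nondegenerate.1 u fun v => ?_
    rw [← hT, hu, LinearMap.map_zero₂]
  have hsurj : Function.Surjective T :=
    (LinearMap.injective_iff_surjective_of_finrank_eq_finrank hdim).1 hinj
  have hsharp {α : Module.Dual ℝ V} {β : Module.Dual ℝ W} (h : ∀ v, β (T v) = α v) :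
      τ.sharp β = T (σ.sharp α) := by
    have h1 : β = τ.form (T (σ.sharp α)) := by
      apply LinearMap.ext
      intro w
      obtain ⟨v, rfl⟩ := hsurj w
      rw [h, hT, form_sharp]
    rw [h1, sharp_form]
  rw [poisson, poisson, hsharp h, hsharp h', hT]

/-! ### Smoothness of the Poisson bracket. -/

section Smoothness

variable {E : Type*} [NormedAddCommGroup E] [NormedSpace ℝ E] [FiniteDimensional ℝ E]
  {M : Type*} [TopologicalSpace M] [ChartedSpace E M]

namespace SymplecticForm

variable (σ : SymplecticForm E M)

/-- The derivative of the inverse of a chart, as an endomorphism of the model space. -/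
def chartFrame (e : OpenPartialHomeomorph M E) (y : E) : E →ₗ[ℝ] TangentSpace 𝓘(ℝ, E) (e.symm y) :=
  (mfderiv 𝓘(ℝ, E) 𝓘(ℝ, E) e.symm y : E →L[ℝ] TangentSpace 𝓘(ℝ, E) (e.symm y)).toLinearMap

/-- The symplectic form in a chart, as a map from the model space to its dual. -/
def chartForm (e : OpenPartialHomeomorph M E) (y : E) : E →L[ℝ] E →L[ℝ] ℝ :=
  LinearMap.toContinuousBilinearMap
    ((σ.at_ (e.symm y)).form.compl₁₂ (chartFrame e y) (chartFrame e y))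

theorem chartForm_apply (e : OpenPartialHomeomorph M E) (y u v : E) :
    σ.chartForm e y u v =
      (σ.at_ (e.symm y)).form (chartFrame e y u) (chartFrame e y v) := rfl

theorem contDiffOn_chartForm {e : OpenPartialHomeomorph M E} (he : e ∈ atlas E M) :
    ContDiffOn ℝ ∞ (σ.chartForm e) e.target := by
  rw [contDiffOn_clm_apply]
  intro u
  rw [contDiffOn_clm_apply]
  intro v
  exact σ.smooth e he u v

variable [IsManifold 𝓘(ℝ, E) ∞ M]

omit [FiniteDimensional ℝ E] in
theorem bijective_chartFrame {e : OpenPartialHomeomorph M E} (he : e ∈ atlas E M) {y : E}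
    (hy : y ∈ e.target) : Function.Bijective (chartFrame e y) := by
  have : IsManifold 𝓘(ℝ, E) 1 M := IsManifold.of_le (n := ∞) (by simp)
  exact (mdifferentiable_of_mem_atlas (I := 𝓘(ℝ, E)) he).symm.mfderiv_bijective hy

theorem isInvertible_chartForm {e : OpenPartialHomeomorph M E} (he : e ∈ atlas E M) {y : E}
    (hy : y ∈ e.target) : (σ.chartForm e y).IsInvertible := by
  have hinj : Function.Injective (σ.chartForm e y).toLinearMap := by
    rw [injective_iff_map_eq_zero]
    intro u hu
    apply (bijective_chartFrame he hy).1
    rw [map_zero]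
    refine (σ.at_ (e.symm y)).nondegenerate.1 _ fun w => ?_
    obtain ⟨v, rfl⟩ := (bijective_chartFrame he hy).2 w
    exact DFunLike.congr_fun (f := σ.chartForm e y u) (g := 0) hu v
  have hfin : Module.finrank ℝ E = Module.finrank ℝ (E →L[ℝ] ℝ) := by
    rw [← (LinearMap.toContinuousLinearMap (𝕜 := ℝ) (E := E) (F' := ℝ)).finrank_eq]
    exact (Subspace.dual_finrank_eq (K := ℝ) (V := E)).symm
  refine ⟨(LinearEquiv.ofInjectiveOfFinrankEq (σ.chartForm e y).toLinearMap hinj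
    hfin).toContinuousLinearEquiv, ?_⟩
  ext u v
  rfl

omit [FiniteDimensional ℝ E] in
theorem fderiv_comp_symm {e : OpenPartialHomeomorph M E} (he : e ∈ atlas E M) {f : M → ℝ}
    (hf : ContMDiff 𝓘(ℝ, E) 𝓘(ℝ, ℝ) ∞ f) {y : E} (hy : y ∈ e.target) (u : E) :
    fderiv ℝ (f ∘ e.symm) y u = differential E f (e.symm y) (chartFrame e y u) := by
  have : IsManifold 𝓘(ℝ, E) 1 M := IsManifold.of_le (n := ∞) (by simp)
  have h1 := HasMFDerivAt.comp y (hf.mdifferentiable (by simp) (e.symm y)).hasMFDerivAt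
    (mdifferentiableAt_atlas_symm he hy).hasMFDerivAt
  let L : E →L[ℝ] E := mfderiv 𝓘(ℝ, E) 𝓘(ℝ, E) e.symm y
  let L' : E →L[ℝ] ℝ := mfderiv 𝓘(ℝ, E) 𝓘(ℝ, ℝ) f (e.symm y)
  have h2 : HasFDerivAt (f ∘ e.symm) (L'.comp L) y := hasMFDerivAt_iff_hasFDerivAt.1 h1
  rw [h2.fderiv]
  rfl

/-- `{f, g} = df(sgrad g)`, where in the chart `sgrad g` is the inverse of the form applied to `dg`.
Smoothness then follows from that of operator inversion. -/
theorem bracket_comp_symm {e : OpenPartialHomeomorph M E} (he : e ∈ atlas E M) {f g : M → ℝ}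
    (hf : ContMDiff 𝓘(ℝ, E) 𝓘(ℝ, ℝ) ∞ f) (hg : ContMDiff 𝓘(ℝ, E) 𝓘(ℝ, ℝ) ∞ g) {y : E}
    (hy : y ∈ e.target) : σ.bracket f g (e.symm y) =
      fderiv ℝ (f ∘ e.symm) y ((σ.chartForm e y).inverse (fderiv ℝ (g ∘ e.symm) y)) := by
  set b := (σ.chartForm e y).inverse (fderiv ℝ (g ∘ e.symm) y) with hb
  have h1 : σ.chartForm e y b = fderiv ℝ (g ∘ e.symm) y := by
    obtain ⟨T, hT⟩ := σ.isInvertible_chartForm he hy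
    rw [hb, ← hT, ContinuousLinearMap.inverse_equiv]
    exact T.apply_symm_apply _
  have h2 : (σ.at_ (e.symm y)).form (chartFrame e y b) = differential E g (e.symm y) := by
    apply LinearMap.ext
    intro w
    obtain ⟨v, rfl⟩ := (bijective_chartFrame he hy).2 w
    rw [← chartForm_apply, h1, fderiv_comp_symm he hg hy]
  rw [bracket, sgrad, LinearSymplecticForm.form_sharp, sgrad, ← h2,
    LinearSymplecticForm.sharp_form, fderiv_comp_symm he hf hy]

theorem contMDiff_bracket {f g : M → ℝ} (hf : ContMDiff 𝓘(ℝ, E) 𝓘(ℝ, ℝ) ∞ f)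
    (hg : ContMDiff 𝓘(ℝ, E) 𝓘(ℝ, ℝ) ∞ g) : ContMDiff 𝓘(ℝ, E) 𝓘(ℝ, ℝ) ∞ (σ.bracket f g) := by
  intro x
  set e := chartAt E x
  have he : e ∈ atlas E M := chart_mem_atlas E x
  have hx : e x ∈ e.target := e.map_source (mem_chart_source E x)
  have hnhds : e.target ∈ 𝓝 (e x) := e.open_target.mem_nhds hx
  have hchart {f : M → ℝ} (hf : ContMDiff 𝓘(ℝ, E) 𝓘(ℝ, ℝ) ∞ f) :
      ContDiffAt ℝ ∞ (fderiv ℝ (f ∘ e.symm)) (e x) := by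
    have h1 : ContMDiffAt 𝓘(ℝ, E) 𝓘(ℝ, E) ∞ e.symm (e x) :=
      (contMDiffOn_chart_symm (I := 𝓘(ℝ, E)) (x := x)).contMDiffAt hnhds
    have h2 : ContMDiffAt 𝓘(ℝ, E) 𝓘(ℝ, ℝ) ∞ (f ∘ e.symm) (e x) :=
      ContMDiffAt.comp (e x) hf.contMDiffAt h1
    exact h2.contDiffAt.fderiv_right (m := ∞) (by simp)
  have hinv : ContDiffAt ℝ ∞ (fun y => (σ.chartForm e y).inverse) (e x) := by
    obtain ⟨T, hT⟩ := σ.isInvertible_chartForm he hx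
    have h1 : ContDiffAt ℝ ∞ ContinuousLinearMap.inverse (σ.chartForm e (e x)) := by
      rw [← hT]
      exact contDiffAt_map_inverse T
    exact h1.comp (e x) ((σ.contDiffOn_chartForm he).contDiffAt hnhds)
  have h3 : ContDiffAt ℝ ∞ (fun y => fderiv ℝ (f ∘ e.symm) y
      ((σ.chartForm e y).inverse (fderiv ℝ (g ∘ e.symm) y))) (e x) :=
    (hchart hf).clm_apply (hinv.clm_apply (hchart hg))
  have h4 : ContMDiffAt 𝓘(ℝ, E) 𝓘(ℝ, E) ∞ e x :=
    (contMDiffOn_chart (I := 𝓘(ℝ, E)) (x := x)).contMDiffAt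
      (e.open_source.mem_nhds (mem_chart_source E x))
  refine (ContMDiffAt.comp x h3.contMDiffAt h4).congr_of_eventuallyEq ?_
  filter_upwards [e.open_source.mem_nhds (mem_chart_source E x)] with z hz
  have h5 := σ.bracket_comp_symm he hf hg (e.map_source hz)
  rw [e.left_inv hz] at h5
  exact h5

end SymplecticForm

end Smoothness

/-! ### Closure of the sum under the Poisson bracket. -/

section PoissonAlgebra

variable {𝔤₀ : Type*} [NormedAddCommGroup 𝔤₀] [NormedSpace ℝ 𝔤₀] [FiniteDimensional ℝ 𝔤₀]
  {G : Type*} [TopologicalSpace G] [ChartedSpace 𝔤₀ G] [Group G] [LieGroup 𝓘(ℝ, 𝔤₀) ∞ G]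
  {E : Type*} [NormedAddCommGroup E] [NormedSpace ℝ E] [FiniteDimensional ℝ E]
  {M : Type*} [TopologicalSpace M] [ChartedSpace E M] [MulAction G M]
  [ContMDiffSMul 𝓘(ℝ, 𝔤₀) 𝓘(ℝ, E) ∞ G M]
  {σ : SymplecticForm E M} {Φ : M → (𝔤₀ →L[ℝ] ℝ)}

theorem SymplecticForm.bracket_eq_poisson (σ : SymplecticForm E M) (f g : M → ℝ) (x : M) :
    σ.bracket f g x = (σ.at_ x).poisson (differential E f x) (differential E g x) := rfl

theorem SymplecticForm.bracket_swap (σ : SymplecticForm E M) (f g : M → ℝ) (x : M) :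
    σ.bracket f g x = -σ.bracket g f x :=
  LinearSymplecticForm.form_swap _ _ _

omit [FiniteDimensional ℝ 𝔤₀] [LieGroup 𝓘(ℝ, 𝔤₀) ∞ G] [FiniteDimensional ℝ E] in
theorem differential_infAction_of_invariant {f : M → ℝ} (hf : f ∈ invariantFunctions E G M)
    (x : M) (ξ : 𝔤₀) : differential E f x (infAction 𝔤₀ E G x ξ) = 0 := by
  have h1 : HasMFDerivAt 𝓘(ℝ, E) 𝓘(ℝ, ℝ) f ((1 : G) • x) (mfderiv 𝓘(ℝ, E) 𝓘(ℝ, ℝ) f x) := by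
    have h2 : ∀ z : M, z = x →
        HasMFDerivAt 𝓘(ℝ, E) 𝓘(ℝ, ℝ) f z (mfderiv 𝓘(ℝ, E) 𝓘(ℝ, ℝ) f x) := by
      rintro z rfl
      exact ((And.left hf).mdifferentiable (by simp) z).hasMFDerivAt
    exact h2 _ (one_smul G x)
  have h3 := HasMFDerivAt.comp (f := fun g : G => g • x) (1 : G) h1
    (hasMFDerivAt_smul_infAction 𝔤₀ G E x)
  have h4 : f ∘ (fun g : G => g • x) = fun _ => f x := funext fun g => And.right hf g x
  rw [h4] at h3
  exact DFunLike.congr_fun (hasMFDerivAt_unique h3 (hasMFDerivAt_const (f x) (1 : G))) ξ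

namespace IsHamiltonianAction

theorem bracket_invariant_mem [IsManifold 𝓘(ℝ, E) ∞ M] (hΦ : IsHamiltonianAction G σ Φ)
    {f₁ f₂ : M → ℝ} (hf₁ : f₁ ∈ invariantFunctions E G M) (hf₂ : f₂ ∈ invariantFunctions E G M) :
    σ.bracket f₁ f₂ ∈ invariantFunctions E G M := by
  refine ⟨σ.contMDiff_bracket (And.left hf₁) (And.left hf₂), fun g x => ?_⟩
  have hs : ContMDiff 𝓘(ℝ, E) 𝓘(ℝ, E) ∞ fun y : M => g • y :=
    (contMDiff_smul (I := 𝓘(ℝ, 𝔤₀)) (I' := 𝓘(ℝ, E)) (n := ∞) (G := G) (M := M)).comp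
      (contMDiff_const.prodMk contMDiff_id)
  let T : TangentSpace 𝓘(ℝ, E) x →ₗ[ℝ] TangentSpace 𝓘(ℝ, E) (g • x) :=
    (mfderiv 𝓘(ℝ, E) 𝓘(ℝ, E) (fun y : M => g • y) x).toLinearMap
  have hd {f : M → ℝ} (hf : f ∈ invariantFunctions E G M) (u : TangentSpace 𝓘(ℝ, E) x) :
      differential E f (g • x) (T u) = differential E f x u := by
    have h1 := HasMFDerivAt.comp x (((And.left hf).mdifferentiable (by simp) (g • x)).hasMFDerivAt)
      ((hs.mdifferentiable (by simp) x).hasMFDerivAt)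
    rw [show f ∘ (fun y : M => g • y) = f from funext fun y => And.right hf g y] at h1
    exact (DFunLike.congr_fun h1.mfderiv u).symm
  exact LinearSymplecticForm.poisson_eq_of_map T (fun u v => hΦ.symplectic g x u v) rfl
    (hd hf₁) (hd hf₂)

/-- The Hamiltonian field of `h ∘ Φ` is tangent to the `G`-orbits, along which `f` is constant. -/
theorem bracket_comp_invariant (hΦ : IsHamiltonianAction G σ Φ) {h : (𝔤₀ →L[ℝ] ℝ) → ℝ}
    (hh : ContDiff ℝ ∞ h) {f : M → ℝ} (hf : f ∈ invariantFunctions E G M) (x : M) :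
    σ.bracket (h ∘ Φ) f x = 0 := by
  rw [SymplecticForm.bracket_swap, SymplecticForm.bracket, SymplecticForm.sgrad,
    LinearSymplecticForm.form_sharp, hΦ.sgrad_comp x (hh.differentiable (by simp) _),
    differential_infAction_of_invariant hf, neg_zero]

omit [ContMDiffSMul 𝓘(ℝ, 𝔤₀) 𝓘(ℝ, E) ∞ G M] in
theorem bracket_comp_comp (hΦ : IsHamiltonianAction G σ Φ) {h₁ h₂ : (𝔤₀ →L[ℝ] ℝ) → ℝ}
    (hh₁ : ContDiff ℝ ∞ h₁) (hh₂ : ContDiff ℝ ∞ h₂) (x : M) :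
    σ.bracket (h₁ ∘ Φ) (h₂ ∘ Φ) x = liePoisson G h₁ h₂ (Φ x) := by
  rw [SymplecticForm.bracket, hΦ.sgrad_comp x (hh₁.differentiable (by simp) _),
    hΦ.sgrad_comp x (hh₂.differentiable (by simp) _), hΦ.form_infAction_infAction, liePoisson]

theorem isPoissonAlgebra [IsManifold 𝓘(ℝ, E) ∞ M] (hΦ : IsHamiltonianAction G σ Φ)
    {A : Submodule ℝ ((𝔤₀ →L[ℝ] ℝ) → ℝ)} (hA : IsLiePoissonAlgebra G A) :
    σ.IsPoissonAlgebra (pullback Φ A ⊔ invariantFunctions E G M) := by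
  have hpull := contMDiff_of_mem_pullback hΦ.smooth_moment hA.smooth
  constructor
  · intro f hf
    obtain ⟨f₁, hf₁, f₂, hf₂, rfl⟩ := Submodule.mem_sup.1 hf
    exact (hpull f₁ hf₁).add (contMDiff_of_mem_invariantFunctions f₂ hf₂)
  · intro f hf g hg
    obtain ⟨_, ⟨h₁, hh₁, rfl⟩, f₂, hf₂, rfl⟩ := Submodule.mem_sup.1 hf
    obtain ⟨_, ⟨h₂, hh₂, rfl⟩, g₂, hg₂, rfl⟩ := Submodule.mem_sup.1 hg
    refine Submodule.mem_sup.2 ⟨liePoisson G h₁ h₂ ∘ Φ, ⟨_, hA.bracket_mem h₁ hh₁ h₂ hh₂, rfl⟩,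
      σ.bracket f₂ g₂, hΦ.bracket_invariant_mem hf₂ hg₂, funext fun x => ?_⟩
    have hd (h : (𝔤₀ →L[ℝ] ℝ) → ℝ) (hh : h ∈ A) (k : M → ℝ) (hk : k ∈ invariantFunctions E G M) :
        differential E (h ∘ Φ + k) x = differential E (h ∘ Φ) x + differential E k x :=
      differential_add ((hpull _ ⟨h, hh, rfl⟩).mdifferentiable (by simp) x)
        ((contMDiff_of_mem_invariantFunctions k hk).mdifferentiable (by simp) x)
    change liePoisson G h₁ h₂ (Φ x) + σ.bracket f₂ g₂ x = σ.bracket (h₁ ∘ Φ + f₂) (h₂ ∘ Φ + g₂) x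
    rw [SymplecticForm.bracket_eq_poisson _ (h₁ ∘ Φ + f₂), hd h₁ hh₁ f₂ hf₂, hd h₂ hh₂ g₂ hg₂,
      LinearSymplecticForm.poisson_add_left, LinearSymplecticForm.poisson_add_right,
      LinearSymplecticForm.poisson_add_right]
    simp only [← SymplecticForm.bracket_eq_poisson]
    rw [hΦ.bracket_comp_comp (hA.smooth h₁ hh₁) (hA.smooth h₂ hh₂),
      hΦ.bracket_comp_invariant (hA.smooth h₁ hh₁) hg₂, SymplecticForm.bracket_swap σ f₂ (h₂ ∘ Φ),
      hΦ.bracket_comp_invariant (hA.smooth h₂ hh₂) hf₂]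
    ring

end IsHamiltonianAction

end PoissonAlgebra

/-! ### The main equivalence -/

section Main

variable {𝔤₀ : Type*} [NormedAddCommGroup 𝔤₀] [NormedSpace ℝ 𝔤₀] [FiniteDimensional ℝ 𝔤₀]
  {G : Type*} [TopologicalSpace G] [ChartedSpace 𝔤₀ G] [Group G] [LieGroup 𝓘(ℝ, 𝔤₀) ∞ G]
  [ConnectedSpace G]
  {E : Type*} [NormedAddCommGroup E] [NormedSpace ℝ E] [FiniteDimensional ℝ E]
  {M : Type*} [TopologicalSpace M] [ChartedSpace E M] [MulAction G M]
  [ContMDiffSMul 𝓘(ℝ, 𝔤₀) 𝓘(ℝ, E) ∞ G M]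
  {σ : SymplecticForm E M} {Φ : M → (𝔤₀ →L[ℝ] ℝ)}
  {A : Submodule ℝ ((𝔤₀ →L[ℝ] ℝ) → ℝ)}

theorem ForGeneral.exists_mem {X : Type*} [TopologicalSpace X] {p : X → Prop} (h : ForGeneral p)
    {U : Set X} (hU : IsOpen U) (hne : U.Nonempty) : ∃ x ∈ U, p x := by
  obtain ⟨V, -, hd, hV⟩ := h
  obtain ⟨x, hxU, hxV⟩ := hd.inter_open_nonempty U hU hne
  exact ⟨x, hxU, hV x hxV⟩

theorem ForGeneral.and {X : Type*} [TopologicalSpace X] {p q : X → Prop} (hp : ForGeneral p)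
    (hq : ForGeneral q) : ForGeneral fun x => p x ∧ q x := by
  obtain ⟨U, hU, hUd, hUp⟩ := hp
  obtain ⟨V, hV, hVd, hVp⟩ := hq
  exact ⟨U ∩ V, hU.inter hV, hUd.inter_of_isOpen_left hVd hU, fun x hx => ⟨hUp x hx.1, hVp x hx.2⟩⟩

omit [FiniteDimensional ℝ 𝔤₀] [ConnectedSpace G] in
theorem coAd_one (μ : 𝔤₀ →L[ℝ] ℝ) : coAd G 1 μ = μ := by
  rw [coAd, inv_one, bigAd_one, ContinuousLinearMap.comp_id]

namespace IsHamiltonianAction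

/-- The part of a coadjoint orbit in the image of the moment map lying in a neighbourhood of `μ`
relative to this image contains a nonempty open subset of the orbit. -/
theorem exists_mem_orbit (hΦ : IsHamiltonianAction G σ Φ) {μ : Set.range Φ}
    {S : Set (Set.range Φ)} (hS : IsOpen S) (hμ : μ ∈ S) {p : CoadjointOrbit G μ.1 → Prop}
    (hp : ForGeneral p) : ∃ ν : CoadjointOrbit G μ.1, p ν ∧ ∃ ν' ∈ S, ν'.1 = ν.1 := by
  obtain ⟨_, x, rfl⟩ := μ
  have hc : Continuous fun g : G => (⟨Φ (g • x), Set.mem_range_self _⟩ : Set.range Φ) := by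
    refine Continuous.subtype_mk (hΦ.smooth_moment.continuous.comp ?_) _
    exact (contMDiff_smul (I := 𝓘(ℝ, 𝔤₀)) (I' := 𝓘(ℝ, E)) (n := ∞) (G := G)
      (M := M)).continuous.comp (continuous_id.prodMk continuous_const)
  -- Openness in the orbit is tested on `G`; by equivariance the preimage of this set is that of `S`
  -- under `g ↦ Φ (g • x)`.
  have hopen : IsOpen {ν : CoadjointOrbit G (Φ x) | ∃ ν' ∈ S, ν'.1 = ν.1} := by
    refine isOpen_coinduced.2 ?_
    convert hS.preimage hc using 1
    ext g
    have hg := hΦ.moment_smul g x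
    constructor
    · rintro ⟨ν', hν', h⟩
      have : ν' = ⟨Φ (g • x), Set.mem_range_self _⟩ := Subtype.ext (h.trans hg.symm)
      rw [Set.mem_preimage, ← this]
      exact hν'
    · intro h
      exact ⟨_, h, hg⟩
  obtain ⟨ν, hν, hpν⟩ := hp.exists_mem hopen ⟨⟨Φ x, 1, coAd_one _⟩, _, hμ, rfl⟩
  exact ⟨ν, hpν, hν⟩

/-- The numbers `l` and `r` are attained at general points of the orbit, possibly not at `μ`. Some
such point lies where the ranks equal those at `μ`, and coisotropy is transferred from it. -/
theorem hasOrbitDims_add_eq_iff (hΦ : IsHamiltonianAction G σ Φ) {μ : Set.range Φ}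
    (hμ : ∀ᶠ ν in 𝓝 μ, orbitRanks G A ν.1 = orbitRanks G A μ.1) {l r : ℕ}
    (hlr : HasOrbitDims G A μ.1 l r) :
    l + r = Module.finrank ℝ (orbitTangent G μ.1) ↔ IsCoisotropicAt G A μ.1 := by
  obtain ⟨S, hS, hSo, hμS⟩ := mem_nhds_iff.1 hμ
  obtain ⟨ν, ⟨h1, h2⟩, ν', hν', hνν'⟩ := hΦ.exists_mem_orbit hSo hμS hlr
  have h3 : orbitRanks G A ν'.1 = orbitRanks G A μ.1 := hS hν'
  rw [hνν'] at h3
  rw [← isCoisotropicAt_iff_of_orbitRanks_eq G h3, ← orbit_coisotropic_iff, h1, h2]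
  simp only [orbitRanks, Prod.mk.injEq] at h3
  rw [h3.2.2]

theorem isCompleteOnOrbit_iff (hΦ : IsHamiltonianAction G σ Φ) (hA : IsLiePoissonAlgebra G A)
    {μ : Set.range Φ} (hμ : ∀ᶠ ν in 𝓝 μ, orbitRanks G A ν.1 = orbitRanks G A μ.1)
    (hlr : ∃ l r : ℕ, HasOrbitDims G A μ.1 l r) :
    IsCompleteOnOrbit G A μ.1 ↔ IsCoisotropicAt G A μ.1 := by
  constructor
  · rintro ⟨-, l, r, h1, h2⟩
    exact (hΦ.hasOrbitDims_add_eq_iff hμ h1).1 h2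
  · intro h
    obtain ⟨l, r, h1⟩ := hlr
    refine ⟨fun h₁ hh₁ h₂ hh₂ => ⟨_, hA.bracket_mem h₁ hh₁ h₂ hh₂, fun ν => ?_⟩, l, r, h1,
      (hΦ.hasOrbitDims_add_eq_iff hμ h1).2 h⟩
    rw [poisson_orbitDifferential]

/-- The numerical condition on `M` does not involve `μ`, so coisotropy holds either at every `μ`
with locally constant ranks or at none. In the converse direction a single such `μ` with a complete
orbit is therefore enough. -/
theorem forGeneral_isCompleteOnOrbit_iff [Nonempty M] (hΦ : IsHamiltonianAction G σ Φ)
    (hinv : InvariantsSpanAnnihilators 𝔤₀ E G M) (hA : IsLiePoissonAlgebra G A) {l r : ℕ}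
    (hM : σ.HasDims (pullback Φ A ⊔ invariantFunctions E G M) l r)
    (hO : ForGeneral fun μ : Set.range Φ => ∃ l r : ℕ, HasOrbitDims G A μ.1 l r) :
    l + r = Module.finrank ℝ E ↔
      ForGeneral fun μ : Set.range Φ => IsCompleteOnOrbit G A μ.1 := by
  obtain ⟨m, hinv⟩ := hinv
  have hM' : ForGeneral fun x : M =>
      Module.finrank ℝ (diffSpan E (pullback Φ A ⊔ invariantFunctions E G M) x) = l ∧
      Module.finrank ℝ ((σ.at_ x).poissonKer
        (diffSpan E (pullback Φ A ⊔ invariantFunctions E G M) x)) = r := hM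
  have hboth := hM'.and hinv
  have hc : Continuous (Set.rangeFactorization Φ) :=
    hΦ.smooth_moment.continuous.subtype_mk _
  have hgen : ForGeneral fun μ : Set.range Φ =>
      ∀ᶠ ν in 𝓝 μ, orbitRanks G A ν.1 = orbitRanks G A μ.1 :=
    ⟨_, isOpen_setOf_eventually_eq, dense_setOf_orbitRanks_eventually_eq G hA.smooth _,
      fun _ h => h⟩
  -- at the points where the ranks are locally constant, completeness can be tested on `M`
  have key (μ : Set.range Φ) (hμ : ∀ᶠ ν in 𝓝 μ, orbitRanks G A ν.1 = orbitRanks G A μ.1) :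
      l + r = Module.finrank ℝ E ↔ IsCoisotropicAt G A μ.1 := by
    obtain ⟨S, hS, hSo, hμS⟩ := mem_nhds_iff.1 hμ
    obtain ⟨x₀, hx₀⟩ := Set.rangeFactorization_surjective μ
    have hne : (Set.rangeFactorization Φ ⁻¹' S).Nonempty :=
      ⟨x₀, by rw [Set.mem_preimage, hx₀]; exact hμS⟩
    -- The neighbourhood of `μ` pulls back to a nonempty open subset of `M`, which contains a
    -- general point.
    obtain ⟨x, hxS, ⟨h1, h2⟩, -, h3⟩ := hboth.exists_mem (hSo.preimage hc) hne
    have hxS' : Set.rangeFactorization Φ x ∈ S := hxS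
    have h4 : orbitRanks G A (Set.rangeFactorization Φ x).1 = orbitRanks G A μ.1 := hS hxS'
    rw [Set.rangeFactorization_coe] at h4
    rw [← isCoisotropicAt_iff_of_orbitRanks_eq G h4, ← hΦ.coisotropic_iff hA.smooth h3, h1, h2]
  constructor
  · intro h
    obtain ⟨U, hU, hUd, hUp⟩ := hgen.and hO
    exact ⟨U, hU, hUd, fun μ hμ => (hΦ.isCompleteOnOrbit_iff hA (hUp μ hμ).1 (hUp μ hμ).2).2
      ((key μ (hUp μ hμ).1).1 h)⟩
  · intro h
    obtain ⟨μ, ⟨h1, h2⟩, h3⟩ : ∃ μ : Set.range Φ,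
        ((∀ᶠ ν in 𝓝 μ, orbitRanks G A ν.1 = orbitRanks G A μ.1) ∧
          ∃ l r : ℕ, HasOrbitDims G A μ.1 l r) ∧ IsCompleteOnOrbit G A μ.1 := by
      have : Nonempty (Set.range Φ) := (Set.range_nonempty Φ).to_subtype
      obtain ⟨μ, -, hμ⟩ := ((hgen.and hO).and h).exists_mem isOpen_univ Set.univ_nonempty
      exact ⟨μ, hμ⟩
    exact (key μ h1).2 ((hΦ.isCompleteOnOrbit_iff hA h1 h2).1 h3)

end IsHamiltonianAction

end Main

end

theorem corollary2p1
    {𝔤₀ : Type*} [NormedAddCommGroup 𝔤₀] [NormedSpace ℝ 𝔤₀] [FiniteDimensional ℝ 𝔤₀]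
    {G : Type*} [TopologicalSpace G] [ChartedSpace 𝔤₀ G] [Group G] [LieGroup 𝓘(ℝ, 𝔤₀) ∞ G]
    [ConnectedSpace G]
    {E : Type*} [NormedAddCommGroup E] [NormedSpace ℝ E] [FiniteDimensional ℝ E]
    {M : Type*} [TopologicalSpace M] [T2Space M] [SecondCountableTopology M] [ConnectedSpace M]
    [ChartedSpace E M] [IsManifold 𝓘(ℝ, E) ∞ M]
    [MulAction G M] [ContMDiffSMul 𝓘(ℝ, 𝔤₀) 𝓘(ℝ, E) ∞ G M]
    (σ : SymplecticForm E M) (Φ : M → (𝔤₀ →L[ℝ] ℝ)) (hΦ : IsHamiltonianAction G σ Φ)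
    (hinv : InvariantsSpanAnnihilators 𝔤₀ E G M)
    (A : Submodule ℝ ((𝔤₀ →L[ℝ] ℝ) → ℝ)) (hA : IsLiePoissonAlgebra G A)
    (hdimsM : ∃ l r : ℕ, σ.HasDims (pullback Φ A ⊔ invariantFunctions E G M) l r)
    (hdimsO : ForGeneral fun μ : Set.range Φ => ∃ l r : ℕ, HasOrbitDims G A μ.1 l r) :
    σ.IsCompleteAlgebra (pullback Φ A ⊔ invariantFunctions E G M) ↔
      ForGeneral fun μ : Set.range Φ => IsCompleteOnOrbit G A μ.1 := by
  constructor
  · rintro ⟨-, l, r, hlr, hdim⟩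
    exact (hΦ.forGeneral_isCompleteOnOrbit_iff hinv hA hlr hdimsO).1 hdim
  · intro h
    obtain ⟨l, r, hlr⟩ := hdimsM
    exact ⟨hΦ.isPoissonAlgebra hA, l, r, hlr,
      (hΦ.forGeneral_isCompleteOnOrbit_iff hinv hA hlr hdimsO).2 h⟩
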